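/- Work with forms in $\mathbb{C}[x,y]$. Call two forms distinct if they are not proportional (i.e. if they are linearly independent over $\mathbb{C}$). Forms $f,g\in\mathbb{C}[x,y]$ are similar if $g(x,y)=f(\alpha x+\beta y,\gamma x+\delta y)$ for some $\alpha,\beta,\gamma,\delta\in\mathbb{C}$ with $\alpha\delta-\beta\gamma\neq 0$. For a binary sextic form $p$, let $N(p)$ be the number of unordered pairs $\{f_1^3,f_2^3\}$, where $f_1,f_2\in\mathbb{C}[x,y]$ are distinct quadratic forms with $p=f_1^3+f_2^3$ (so neither the order of the summands nor cube roots of unity multiplying the $f_j$ matter). For $t\in\mathbb{C}$ put $$A_t=x^6+tx^4y^2+tx^2y^4+y^6,\qquad B_t=x^6+tx^3y^3+y^6,$$ and let $Q_1=x^6+y^6$ and $Q_2=xy(x^4-y^4)$. **Theorem.** A binary sextic form $p\in\mathbb{C}[x,y]$ satisfies $N(p)>3$ if and only if $p$ is similar to $Q_1$ or to $Q_2$, and $Q_1$ and $Q_2$ are not similar to each other. Moreover, $N(Q_1)=4$ and $N(Q_2)=6$; $Q_1$ is similar to $A_0$, $A_{15}$ and $B_0$; and $Q_2$ is similar to $A_{-5}$,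 $B_{5\sqrt{-2}}$ and $B_{-5\sqrt{-2}}$. -/

import Mathlib

noncomputable section

namespace TwoCubes

open MvPolynomial

/-- Polynomials in the two variables `x = X 0` and `y = X 1` over `ℂ`. A binary form of degree `d`
is an element `f` with `f.IsHomogeneous d`. -/
abbrev Poly2 : Type := MvPolynomial (Fin 2) ℂ

/-- `f ∘ M`: the polynomial `f(αx + βy, γx + δy)`, where `M` has rows `(α, β)` and `(γ, δ)`. -/
def comp (f : Poly2) (M : Matrix (Fin 2) (Fin 2) ℂ) : Poly2 :=
  bind₁ (fun i => C (M i 0) * X 0 + C (M i 1) * X 1) f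

/-- `f` and `g` are similar: `g = f ∘ M` for some invertible linear change of variables `M`. -/
def Similar (f g : Poly2) : Prop :=
  ∃ M : Matrix.GeneralLinearGroup (Fin 2) ℂ, g = comp f (M : Matrix (Fin 2) (Fin 2) ℂ)

/-- Two forms are distinct if they are not proportional (the zero form is proportional to
every form). -/
def Distinct (f g : Poly2) : Prop :=
  LinearIndependent ℂ ![f, g]

/-- The representations of `p` as an honest sum of two cubes, `p = f ^ 3 + g ^ 3` with `f`, `g`
distinct binary quadratic forms. A representation is recorded as the unordered pair
`{f ^ 3, g ^ 3}`, so that neither the order of the summands nor cube roots of unity multiplying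
the quadratic forms matter. -/
def representations (p : Poly2) : Set (Sym2 Poly2) :=
  {s | ∃ f g : Poly2, f.IsHomogeneous 2 ∧ g.IsHomogeneous 2 ∧ Distinct f g ∧
    p = f ^ 3 + g ^ 3 ∧ s = s(f ^ 3, g ^ 3)}

/-- `N p`: the number of ways in which `p` is an honest sum of two cubes of binary quadratic
forms (`⊤` if there are infinitely many). -/
def N (p : Poly2) : ℕ∞ :=
  (representations p).encard

/-- `A_t = x^6 + t x^4 y^2 + t x^2 y^4 + y^6`. -/
def A (t : ℂ) : Poly2 :=
  X 0 ^ 6 + C t * X 0 ^ 4 * X 1 ^ 2 + C t * X 0 ^ 2 * X 1 ^ 4 + X 1 ^ 6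

/-- `B_t = x^6 + t x^3 y^3 + y^6`. -/
def B (t : ℂ) : Poly2 :=
  X 0 ^ 6 + C t * X 0 ^ 3 * X 1 ^ 3 + X 1 ^ 6

/-- `Q_1 = x^6 + y^6`. -/
def Q₁ : Poly2 := X 0 ^ 6 + X 1 ^ 6

/-- `Q_2 = x y (x^4 - y^4)`. -/
def Q₂ : Poly2 := X 0 * X 1 * (X 0 ^ 4 - X 1 ^ 4)

end TwoCubes

end

/-!
Write `ω` for a primitive cube root of unity. The identity
`f³ + g³ = (f + g) (f + ω g) (f + ω² g)` turns a representation of `p` as a sum of two cubes into a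
factorization of `p` into three pairwise distinct quadratic forms that lie in one pencil, and
conversely a pencil contains at most one pair of cubes with sum `p` (`Distinct.cubes_unique`,
`exists_repWith_of_eq_mul`). A pencil of quadratic forms is the kernel of a functional `apolar β`,
that is, of a symmetric bilinear form `polar β` on `ℂ²`; the zeros of a member of the pencil are
orthogonal for this form.

If `p` has a multiple zero, few factorizations are available and `N p ≤ 3`
(`N_le_three_of_sq_dvd`). If the six zeros are distinct, then `polar β` is nondegenerate, and
orthogonality is an involution of the projective line that permutes the zeros without fixed points.
So `N p` is the number of pairings of the six zeros that are induced by an involution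
(`N_prod_lin`).

If there are more than three such pairings, two of them are disjoint
(`exists_disjoint_pairings`), so their union is a hexagon. The product of the two involutions then
permutes every other vertex cyclically; in coordinates in which three of these vertices are
`1, ω, ω²` it is multiplication by a cube root of unity, and the zeros are
`1, ω, ω², c, ω c, ω² c` (`exists_similar_hexad`). Three of the fifteen pairings of these points are
always involutive, and a fourth one is only if `c³ = -1` or `c⁶ + 52 c³ + 1 = 0`
(`involutive_hexad`). In the first case the zeros form a regular hexagon and `p` is similar to `Q₁`.
In the second case `p` is similar to `B t` with `t² = -50`, the octahedral form `Q₂` written in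
coordinates adapted to an axis of order three (`similar_Q₂_B`). The values `N Q₁ = 4` and
`N Q₂ = 6` come from testing the fifteen pairings of the zeros, and they show that `Q₁` and `Q₂` are
not similar.
-/

namespace TwoCubes

open MvPolynomial

/-! ### Linear changes of variables -/

lemma comp_add (f g : Poly2) (M : Matrix (Fin 2) (Fin 2) ℂ) :
    comp (f + g) M = comp f M + comp g M := by simp [comp]

lemma comp_mul (f g : Poly2) (M : Matrix (Fin 2) (Fin 2) ℂ) :
    comp (f * g) M = comp f M * comp g M := by simp [comp]

lemma comp_pow (f : Poly2) (n : ℕ) (M : Matrix (Fin 2) (Fin 2) ℂ) :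
    comp (f ^ n) M = comp f M ^ n := by simp [comp]

lemma comp_sub (f g : Poly2) (M : Matrix (Fin 2) (Fin 2) ℂ) :
    comp (f - g) M = comp f M - comp g M := by simp [comp]

lemma comp_C (a : ℂ) (M : Matrix (Fin 2) (Fin 2) ℂ) : comp (C a) M = C a := by simp [comp]

lemma comp_X (i : Fin 2) (M : Matrix (Fin 2) (Fin 2) ℂ) :
    comp (X i) M = C (M i 0) * X 0 + C (M i 1) * X 1 := by simp [comp]

lemma comp_comp (f : Poly2) (M M' : Matrix (Fin 2) (Fin 2) ℂ) :
    comp (comp f M) M' = comp f (M * M') := by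
  unfold comp
  rw [bind₁_bind₁]
  congr 2
  funext i
  simp only [map_add, map_mul, bind₁_C_right, bind₁_X_right, Matrix.mul_apply, Fin.sum_univ_two]
  ring

lemma comp_one (f : Poly2) : comp f 1 = f := by
  have h : (fun i : Fin 2 => C ((1 : Matrix (Fin 2) (Fin 2) ℂ) i 0) * X 0
      + C ((1 : Matrix (Fin 2) (Fin 2) ℂ) i 1) * X 1) = (X : Fin 2 → Poly2) := by
    funext i
    revert i
    exact Fin.forall_fin_two.2 ⟨by simp, by simp⟩
  unfold comp
  rw [h, bind₁_X_left]
  rfl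

lemma isHomogeneous_comp {f : Poly2} {n : ℕ} (hf : f.IsHomogeneous n)
    (M : Matrix (Fin 2) (Fin 2) ℂ) : (comp f M).IsHomogeneous n := by
  have := hf.aeval (S := ℂ) (fun i : Fin 2 => C (M i 0) * X 0 + C (M i 1) * X (1 : Fin 2))
    (n := 1) (fun i => (by
      simpa using ((isHomogeneous_C _ _).mul (isHomogeneous_X _ _)).add
        ((isHomogeneous_C _ _).mul (isHomogeneous_X _ _))))
  rw [one_mul] at this
  exact this

lemma comp_GL_inv (f : Poly2) (M : Matrix.GeneralLinearGroup (Fin 2) ℂ) :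
    comp (comp f M.val) (M⁻¹).val = f := by
  rw [comp_comp, ← Units.val_mul, mul_inv_cancel, Units.val_one, comp_one]

lemma comp_inv_GL (f : Poly2) (M : Matrix.GeneralLinearGroup (Fin 2) ℂ) :
    comp (comp f (M⁻¹).val) M.val = f := by
  rw [comp_comp, ← Units.val_mul, inv_mul_cancel, Units.val_one, comp_one]

lemma comp_injective (M : Matrix.GeneralLinearGroup (Fin 2) ℂ) :
    Function.Injective (fun f : Poly2 => comp f M.val) :=
  Function.LeftInverse.injective (g := fun f => comp f (M⁻¹).val) (fun f => comp_GL_inv f M)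

lemma Similar.symm {f g : Poly2} (h : Similar f g) : Similar g f := by
  obtain ⟨M, rfl⟩ := h
  exact ⟨M⁻¹, (comp_GL_inv f M).symm⟩

lemma Similar.trans {f g h : Poly2} (h₁ : Similar f g) (h₂ : Similar g h) : Similar f h := by
  obtain ⟨M, rfl⟩ := h₁
  obtain ⟨M', rfl⟩ := h₂
  exact ⟨M * M', by rw [comp_comp, Units.val_mul]⟩

lemma Similar.refl (f : Poly2) : Similar f f := ⟨1, by rw [Units.val_one, comp_one]⟩

lemma comp_smul_one {f : Poly2} {n : ℕ} (hf : f.IsHomogeneous n) (s : ℂ) :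
    comp f (s • 1) = C (s ^ n) * f := by
  have h : (fun i : Fin 2 => C ((s • (1 : Matrix (Fin 2) (Fin 2) ℂ)) i 0) * X 0
      + C ((s • (1 : Matrix (Fin 2) (Fin 2) ℂ)) i 1) * X 1)
        = (fun i => C s * X i : Fin 2 → Poly2) := by
    funext i
    revert i
    exact Fin.forall_fin_two.2 ⟨by simp, by simp⟩
  unfold comp
  rw [h]
  conv_lhs => rw [f.as_sum]
  conv_rhs => rw [f.as_sum]
  rw [map_sum, Finset.mul_sum]
  refine Finset.sum_congr rfl fun d hd => ?_
  have hdn : ∑ i ∈ d.support, d i = n := by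
    simpa [Finsupp.weight_apply, Finsupp.sum] using hf (mem_support_iff.mp hd)
  rw [bind₁_monomial, monomial_eq, Finsupp.prod]
  simp only [mul_pow, Finset.prod_mul_distrib]
  rw [Finset.prod_pow_eq_pow_sum, hdn, C_pow]
  ring

/-- Over `ℂ`, a scalar factor can be absorbed into the change of variables. -/
lemma Similar.of_comp_eq {f g : Poly2} (hf : f.IsHomogeneous 6) (M : Matrix (Fin 2) (Fin 2) ℂ)
    (hM : M.det ≠ 0) {c : ℂ} (hc : c ≠ 0) (h : comp f M = C c * g) : Similar f g := by
  obtain ⟨s, hs⟩ := IsAlgClosed.exists_pow_nat_eq c⁻¹ (n := 6) (by norm_num)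
  have hs0 : s ≠ 0 := by
    rintro rfl
    exact inv_ne_zero hc (by rw [← hs]; norm_num)
  refine ⟨Matrix.GeneralLinearGroup.mkOfDetNeZero (M * (s • 1)) ?_, ?_⟩
  · rw [Matrix.det_mul, Matrix.det_smul]
    simp [hM, hs0]
  · have : comp (comp f M) (s • 1) = g := by
      rw [comp_smul_one (isHomogeneous_comp hf M), h, hs, ← mul_assoc, ← C_mul,
        inv_mul_cancel₀ hc, C_1, one_mul]
    rw [← this, comp_comp]
    rfl

lemma Distinct.comp {f g : Poly2} (h : Distinct f g) (M : Matrix.GeneralLinearGroup (Fin 2) ℂ) :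
    Distinct (TwoCubes.comp f M.val) (TwoCubes.comp g M.val) := by
  unfold Distinct at *
  rw [LinearIndependent.pair_iff] at *
  intro s t hst
  refine h s t (comp_injective M ?_)
  simp only [smul_eq_C_mul, comp_add, comp_mul, comp_C] at hst ⊢
  rw [hst, ← C_0, comp_C]

lemma representations_comp (p : Poly2) (M : Matrix.GeneralLinearGroup (Fin 2) ℂ) :
    representations (comp p M.val) =
      Sym2.map (fun f => comp f M.val) '' representations p := by
  ext s
  constructor
  · rintro ⟨f, g, hf, hg, hfg, hp, rfl⟩
    refine ⟨s(comp f (M⁻¹).val ^ 3, comp g (M⁻¹).val ^ 3),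
      ⟨_, _, isHomogeneous_comp hf _, isHomogeneous_comp hg _, hfg.comp M⁻¹, ?_, rfl⟩, ?_⟩
    · rw [← comp_pow, ← comp_pow, ← comp_add, ← hp, comp_GL_inv]
    · simp only [Sym2.map_mk, comp_pow, comp_inv_GL]
  · rintro ⟨_, ⟨f, g, hf, hg, hfg, rfl, rfl⟩, rfl⟩
    exact ⟨_, _, isHomogeneous_comp hf _, isHomogeneous_comp hg _, hfg.comp M,
      by simp only [comp_add, comp_pow], by simp only [Sym2.map_mk, comp_pow]⟩

lemma Similar.N_eq {p q : Poly2} (h : Similar p q) : N p = N q := by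
  obtain ⟨M, rfl⟩ := h
  unfold N
  rw [representations_comp, (Sym2.map.injective (comp_injective M)).encard_image]

/-! ### Linear and quadratic binary forms -/

/-- The determinant of the pair of vectors `(v, w)`; it vanishes iff `v` and `w` are parallel. -/
noncomputable def wedge (v w : Fin 2 → ℂ) : ℂ := v 0 * w 1 - v 1 * w 0

/-- The linear form whose zero on the projective line is the point `w`. -/
noncomputable def lin (w : Fin 2 → ℂ) : Poly2 := C (w 1) * X 0 - C (w 0) * X 1

/-- The binary quadratic form `a x² + b x y + c y²`. -/
noncomputable def quad (a b c : ℂ) : Poly2 := C a * X 0 ^ 2 + C b * (X 0 * X 1) + C c * X 1 ^ 2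

lemma eval_lin (v w : Fin 2 → ℂ) : eval v (lin w) = wedge v w := by
  simp [lin, wedge]; ring

lemma eval_quad (v : Fin 2 → ℂ) (a b c : ℂ) :
    eval v (quad a b c) = a * v 0 ^ 2 + b * (v 0 * v 1) + c * v 1 ^ 2 := by simp [quad]

lemma wedge_self (v : Fin 2 → ℂ) : wedge v v = 0 := by unfold wedge; ring

lemma wedge_swap (v w : Fin 2 → ℂ) : wedge v w = -wedge w v := by unfold wedge; ring

lemma exists_smul_of_wedge_eq_zero {v w : Fin 2 → ℂ} (hv : v ≠ 0) (h : wedge v w = 0) :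
    ∃ t : ℂ, w = t • v := by
  unfold wedge at h
  by_cases h0 : v 0 = 0
  · have h1 : v 1 ≠ 0 := fun h1 => hv (funext (Fin.forall_fin_two.2 ⟨h0, h1⟩))
    refine ⟨w 1 / v 1, funext (Fin.forall_fin_two.2 ⟨?_, ?_⟩)⟩
    · simp only [h0, zero_mul, zero_sub, neg_eq_zero, mul_eq_zero, h1, false_or] at h
      simp [h0, h]
    · simp [h1]
  · refine ⟨w 0 / v 0, funext (Fin.forall_fin_two.2 ⟨?_, ?_⟩)⟩
    · simp [h0]
    · simp only [Pi.smul_apply, smul_eq_mul]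
      field_simp
      linear_combination h

lemma lin_smul (t : ℂ) (w : Fin 2 → ℂ) : lin (t • w) = C t * lin w := by
  simp only [lin, Pi.smul_apply, smul_eq_mul, C_mul]; ring

lemma lin_zero : lin 0 = 0 := by simp [lin]

lemma lin_ne_zero {w : Fin 2 → ℂ} (hw : w ≠ 0) : lin w ≠ 0 := by
  intro h
  refine hw (funext (Fin.forall_fin_two.2 ⟨?_, ?_⟩))
  · simpa [lin] using congrArg (eval ![0, 1]) h
  · simpa [lin] using congrArg (eval ![1, 0]) h

lemma ne_zero_of_wedge {v w : Fin 2 → ℂ} (h : wedge v w ≠ 0) : v ≠ 0 := by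
  rintro rfl
  exact h (by simp [wedge])

lemma isHomogeneous_lin (w : Fin 2 → ℂ) : (lin w).IsHomogeneous 1 := by
  have h (a : ℂ) (i : Fin 2) : (C a * X i : Poly2).IsHomogeneous 1 := by
    simpa using (isHomogeneous_C (Fin 2) a).mul (isHomogeneous_X ℂ i)
  exact (h _ _).sub (h _ _)

lemma isHomogeneous_lin_mul_lin (v w : Fin 2 → ℂ) : (lin v * lin w).IsHomogeneous 2 :=
  (isHomogeneous_lin v).mul (isHomogeneous_lin w)

lemma isHomogeneous_C_mul {f : Poly2} {n : ℕ} (hf : f.IsHomogeneous n) (a : ℂ) :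
    (C a * f).IsHomogeneous n := by
  simpa using (isHomogeneous_C (Fin 2) a).mul hf

lemma quad_eq_monomials (a b c : ℂ) : quad a b c = monomial (Finsupp.single 0 2) a +
    monomial (Finsupp.single 0 1 + Finsupp.single 1 1) b + monomial (Finsupp.single 1 2) c := by
  rw [quad, X_pow_eq_monomial, X_pow_eq_monomial]
  simp only [C_mul_monomial, mul_one, X, monomial_mul]

lemma exists_eq_quad {f : Poly2} (hf : f.IsHomogeneous 2) : ∃ a b c, f = quad a b c := by
  refine ⟨coeff (Finsupp.single 0 2) f, coeff (Finsupp.single 0 1 + Finsupp.single 1 1) f,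
    coeff (Finsupp.single 1 2) f, ?_⟩
  ext d
  have hd : d = Finsupp.single 0 (d 0) + Finsupp.single 1 (d 1) := by
    ext i
    revert i
    exact Fin.forall_fin_two.2 ⟨by simp, by simp⟩
  rw [quad_eq_monomials]
  simp only [coeff_add, coeff_monomial]
  by_cases h : d 0 + d 1 = 2
  · have : (d 0 = 2 ∧ d 1 = 0) ∨ (d 0 = 1 ∧ d 1 = 1) ∨ (d 0 = 0 ∧ d 1 = 2) := by omega
    rcases this with ⟨h0, h1⟩ | ⟨h0, h1⟩ | ⟨h0, h1⟩ <;> rw [h0, h1] at hd <;> subst hd <;>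
      simp [Finsupp.ext_iff, Fin.forall_fin_two]
  · rw [hf.coeff_eq_zero (by simpa [Finsupp.degree_eq_sum] using h)]
    have h1 : Finsupp.single 0 2 ≠ d := by rintro rfl; simp at h
    have h2 : Finsupp.single 0 1 + Finsupp.single 1 1 ≠ d := by rintro rfl; simp at h
    have h3 : Finsupp.single 1 2 ≠ d := by rintro rfl; simp at h
    simp [h1, h2, h3]

lemma exists_eq_lin_mul_lin_of_eval_eq_zero {f : Poly2} (hf : f.IsHomogeneous 2) {w : Fin 2 → ℂ}
    (hw : w ≠ 0) (h : eval w f = 0) : ∃ a, f = lin w * lin a := by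
  obtain ⟨a, b, c, rfl⟩ := exists_eq_quad hf
  rw [eval_quad] at h
  by_cases h1 : w 1 = 0
  · have h0 : w 0 ≠ 0 := fun h0 => hw (funext (Fin.forall_fin_two.2 ⟨h0, h1⟩))
    have ha : a = 0 := by simpa [h1, h0] using h
    refine ⟨![c / w 0, -b / w 0], ?_⟩
    have e1 : (C b : Poly2) = -(C (w 0) * C (-b / w 0)) := by
      rw [← C_mul, ← C_neg]; congr 1; field_simp
    have e2 : (C c : Poly2) = C (w 0) * C (c / w 0) := by
      rw [← C_mul]; congr 1; field_simp
    simp only [quad, lin, ha, h1, C_0, Matrix.cons_val_zero, Matrix.cons_val_one]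
    linear_combination (X 0 * X 1) * e1 + X 1 ^ 2 * e2
  · refine ⟨![-(b + w 0 * a / w 1) / w 1, a / w 1], ?_⟩
    have e1 : (C a : Poly2) = C (w 1) * C (a / w 1) := by
      rw [← C_mul]; congr 1; field_simp
    have e2 : (C b : Poly2) = -(C (w 1) * C (-(b + w 0 * a / w 1) / w 1) +
        C (w 0) * C (a / w 1)) := by
      rw [← C_mul, ← C_mul, ← C_add, ← C_neg]; congr 1; field_simp; ring
    have e3 : (C c : Poly2) = C (w 0) * C (-(b + w 0 * a / w 1) / w 1) := by
      rw [← C_mul]; congr 1; field_simp; linear_combination h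
    simp only [quad, lin, Matrix.cons_val_zero, Matrix.cons_val_one]
    linear_combination X 0 ^ 2 * e1 + (X 0 * X 1) * e2 + X 1 ^ 2 * e3

lemma exists_root_quadratic {a : ℂ} (b c : ℂ) (ha : a ≠ 0) : ∃ z, a * z ^ 2 + b * z + c = 0 := by
  obtain ⟨z, hz⟩ := IsAlgClosed.exists_root
    (Polynomial.C a * Polynomial.X ^ 2 + Polynomial.C b * Polynomial.X + Polynomial.C c)
    (by rw [Polynomial.degree_quadratic ha]; norm_num)
  exact ⟨z, by simpa [Polynomial.IsRoot] using hz⟩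

lemma exists_root_cubic {a : ℂ} (b c d : ℂ) (ha : a ≠ 0) :
    ∃ z, a * z ^ 3 + b * z ^ 2 + c * z + d = 0 := by
  obtain ⟨z, hz⟩ := IsAlgClosed.exists_root
    (Polynomial.C a * Polynomial.X ^ 3 + Polynomial.C b * Polynomial.X ^ 2 +
      Polynomial.C c * Polynomial.X + Polynomial.C d)
    (by rw [Polynomial.degree_cubic ha]; norm_num)
  exact ⟨z, by simpa [Polynomial.IsRoot] using hz⟩

lemma exists_eq_lin_mul_lin {f : Poly2} (hf : f.IsHomogeneous 2) :
    ∃ v w, f = lin v * lin w := by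
  obtain ⟨w, hw, h⟩ : ∃ w : Fin 2 → ℂ, w ≠ 0 ∧ eval w f = 0 := by
    obtain ⟨a, b, c, rfl⟩ := exists_eq_quad hf
    by_cases ha : a = 0
    · exact ⟨![1, 0], fun h => by simpa using congrFun h 0, by simp [eval_quad, ha]⟩
    · obtain ⟨z, hz⟩ := exists_root_quadratic b c ha
      exact ⟨![z, 1], fun h => by simpa using congrFun h 1, by simpa [eval_quad] using hz⟩
  exact ⟨w, exists_eq_lin_mul_lin_of_eval_eq_zero hf hw h⟩

/-! ### Distinct forms and their cubes -/

lemma distinct_iff {f g : Poly2} :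
    Distinct f g ↔ ∀ s t : ℂ, C s * f + C t * g = 0 → s = 0 ∧ t = 0 := by
  unfold Distinct
  rw [LinearIndependent.pair_iff]
  simp only [smul_eq_C_mul]

lemma Distinct.symm {f g : Poly2} (h : Distinct f g) : Distinct g f := by
  rw [distinct_iff] at *
  intro s t hst
  exact (h t s (by rw [← hst]; ring)).symm

lemma Distinct.ne_zero {f g : Poly2} (h : Distinct f g) : f ≠ 0 := by
  rintro rfl
  simpa using (distinct_iff.1 h 1 0 (by simp)).1

/-- An invertible linear substitution keeps two forms distinct. -/
lemma Distinct.combine {f g : Poly2} (h : Distinct f g) {a b c d : ℂ} (hd : a * d - b * c ≠ 0) :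
    Distinct (C a * f + C b * g) (C c * f + C d * g) := by
  rw [distinct_iff] at *
  intro s t hst
  obtain ⟨h1, h2⟩ := h (s * a + t * c) (s * b + t * d) (by
    rw [← hst]; simp only [C_add, C_mul]; ring)
  constructor
  · refine (mul_eq_zero.1 (?_ : s * (a * d - b * c) = 0)).resolve_right hd
    linear_combination d * h1 - c * h2
  · refine (mul_eq_zero.1 (?_ : t * (a * d - b * c) = 0)).resolve_right hd
    linear_combination a * h2 - b * h1

lemma Distinct.quadratic_eq_zero {f g : Poly2} (h : Distinct f g) {a b c : ℂ}
    (h0 : C a * f ^ 2 + C b * (f * g) + C c * g ^ 2 = 0) : a = 0 ∧ b = 0 ∧ c = 0 := by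
  have hl := distinct_iff.1 h
  by_cases ha : a = 0
  · subst ha
    refine ⟨rfl, hl b c ((mul_eq_zero.1 (?_ : g * _ = 0)).resolve_left h.symm.ne_zero)⟩
    rw [C_0] at h0
    linear_combination h0
  · obtain ⟨r, hr⟩ := exists_root_quadratic b c ha
    have hr' : (C a * C r ^ 2 + C b * C r + C c : Poly2) = 0 := by
      rw [← C_pow, ← C_mul, ← C_mul, ← C_add, ← C_add, hr, C_0]
    have : (C 1 * f + C (-r) * g) * (C a * f + C (b + a * r) * g) = 0 := by
      simp only [C_1, C_neg, C_add, C_mul]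
      linear_combination h0 - g ^ 2 * hr'
    rcases mul_eq_zero.1 this with h1 | h1
    · exact absurd (hl _ _ h1).1 one_ne_zero
    · exact absurd (hl _ _ h1).1 ha

lemma Distinct.cubic_eq_zero {f g : Poly2} (h : Distinct f g) {a b c d : ℂ}
    (h0 : C a * f ^ 3 + C b * (f ^ 2 * g) + C c * (f * g ^ 2) + C d * g ^ 3 = 0) :
    a = 0 ∧ b = 0 ∧ c = 0 ∧ d = 0 := by
  by_cases ha : a = 0
  · subst ha
    refine ⟨rfl, h.quadratic_eq_zero
      ((mul_eq_zero.1 (?_ : g * _ = 0)).resolve_left h.symm.ne_zero)⟩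
    rw [C_0] at h0
    linear_combination h0
  · obtain ⟨r, hr⟩ := exists_root_cubic b c d ha
    have hr' : (C a * C r ^ 3 + C b * C r ^ 2 + C c * C r + C d : Poly2) = 0 := by
      rw [← C_pow, ← C_pow, ← C_mul, ← C_mul, ← C_mul, ← C_add, ← C_add, ← C_add, hr, C_0]
    have : (C 1 * f + C (-r) * g) * (C a * f ^ 2 + C (b + a * r) * (f * g)
        + C (c + b * r + a * r ^ 2) * g ^ 2) = 0 := by
      simp only [C_1, C_neg, C_add, C_mul, C_pow]
      linear_combination h0 - g ^ 3 * hr'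
    rcases mul_eq_zero.1 this with h1 | h1
    · exact absurd (distinct_iff.1 h _ _ h1).1 one_ne_zero
    · exact absurd (h.quadratic_eq_zero h1).1 ha

/-- A pencil of forms contains at most one pair of cubes with a given sum: a binary cubic form
with three distinct roots is a sum of two cubes in only one way. -/
lemma Distinct.cubes_unique {f g h k : Poly2} (hfg : Distinct f g) (hhk : Distinct h k)
    {a b c d : ℂ} (hh : h = C a * f + C b * g) (hk : k = C c * f + C d * g)
    (e : f ^ 3 + g ^ 3 = h ^ 3 + k ^ 3) : s(f ^ 3, g ^ 3) = s(h ^ 3, k ^ 3) := by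
  have e0 : C (a ^ 3 + c ^ 3 - 1) * f ^ 3 + C (3 * (a ^ 2 * b + c ^ 2 * d)) * (f ^ 2 * g)
      + C (3 * (a * b ^ 2 + c * d ^ 2)) * (f * g ^ 2) + C (b ^ 3 + d ^ 3 - 1) * g ^ 3 = 0 := by
    rw [hh, hk] at e
    simp only [C_sub, C_add, C_mul, C_pow, C_1, map_ofNat]
    linear_combination -e
  obtain ⟨h1, h2, h3, h4⟩ := hfg.cubic_eq_zero e0
  have h2' : a ^ 2 * b + c ^ 2 * d = 0 := by linear_combination h2 / 3
  have h3' : a * b ^ 2 + c * d ^ 2 = 0 := by linear_combination h3 / 3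
  -- the two mixed coefficients vanish, and `(a, b)`, `(c, d)` are independent
  have hdet : a * d - b * c ≠ 0 := by
    intro h0
    have hz := distinct_iff.1 hhk
    have hc := hz c (-a) (by
      have h0' : (C a * C d - C b * C c : Poly2) = 0 := by
        rw [← C_mul, ← C_mul, ← C_sub, h0, C_0]
      rw [hh, hk, C_neg]; linear_combination (-g) * h0')
    have hd := hz d (-b) (by
      have h0' : (C a * C d - C b * C c : Poly2) = 0 := by
        rw [← C_mul, ← C_mul, ← C_sub, h0, C_0]
      rw [hh, hk, C_neg]; linear_combination f * h0')
    have ha : a = 0 := by simpa using hc.2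
    rw [ha, hc.1] at h1
    norm_num at h1
  have hab : a * b = 0 := by
    by_contra hab
    have hcd : (a * b) * (a * d - b * c) = 0 ∨ c * d = 0 := by
      right
      by_contra hcd
      have ha : a ≠ 0 := left_ne_zero_of_mul hab
      have hb : b ≠ 0 := right_ne_zero_of_mul hab
      -- `a² b = - c² d` and `a b² = - c d²` give `a / b = c / d`
      have : (a * b) * (c * d) * (a * d - b * c) = 0 := by
        linear_combination (c * d ^ 2) * h2' - (c ^ 2 * d) * h3'
      exact mul_ne_zero (mul_ne_zero hab hcd) hdet this
    rcases hcd with h | h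
    · exact mul_ne_zero hab hdet h
    · have : a ^ 2 * b = 0 := by
        linear_combination h2' - c * h
      rcases mul_eq_zero.1 this with h5 | h5
      · exact hab (by rw [pow_eq_zero_iff (by norm_num)] at h5; rw [h5]; ring)
      · exact hab (by rw [h5]; ring)
  have key (r : ℂ) (q q' : Poly2) (hr : r ^ 3 = 1) (hq : q' = C r * q) : q ^ 3 = q' ^ 3 := by
    rw [hq, mul_pow, ← C_pow, hr, C_1, one_mul]
  rcases mul_eq_zero.1 hab with h5 | h5
  · have hc : c ≠ 0 := by rintro rfl; exact hdet (by rw [h5]; ring)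
    have hd : d = 0 := by
      rw [h5] at h2'
      simpa [hc] using h2'
    rw [Sym2.eq_swap]
    rw [key b g h (by rw [hd] at h4; linear_combination h4) (by rw [hh, h5, C_0]; ring),
      key c f k (by rw [h5] at h1; linear_combination h1) (by rw [hk, hd, C_0]; ring)]
  · have hd : d ≠ 0 := by rintro rfl; exact hdet (by rw [h5]; ring)
    have hc : c = 0 := by
      rw [h5] at h3'
      simpa [hd] using h3'
    rw [key a f h (by rw [hc] at h1; linear_combination h1) (by rw [hh, h5, C_0]; ring),
      key d g k (by rw [h5] at h4; linear_combination h4) (by rw [hk, hc, C_0]; ring)]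

/-! ### Apolarity -/

/-- The linear functional `a x² + b x y + c y² ↦ β₀ a + β₁ b + β₂ c` on quadratic forms. -/
noncomputable def apolar (β : Fin 3 → ℂ) : Poly2 →ₗ[ℂ] ℂ :=
  β 0 • lcoeff ℂ (Finsupp.single 0 2) + β 1 • lcoeff ℂ (Finsupp.single 0 1 + Finsupp.single 1 1) +
    β 2 • lcoeff ℂ (Finsupp.single 1 2)

/-- The value of `apolar β` at `lin v * lin w`, a symmetric bilinear form in `v` and `w`. -/
noncomputable def polar (β : Fin 3 → ℂ) (v w : Fin 2 → ℂ) : ℂ :=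
  β 0 * (v 1 * w 1) - β 1 * (v 1 * w 0 + v 0 * w 1) + β 2 * (v 0 * w 0)

lemma apolar_C_mul (β : Fin 3 → ℂ) (t : ℂ) (f : Poly2) :
    apolar β (C t * f) = t * apolar β f := by
  rw [← smul_eq_C_mul, map_smul, smul_eq_mul]

lemma apolar_quad (β : Fin 3 → ℂ) (a b c : ℂ) :
    apolar β (quad a b c) = β 0 * a + β 1 * b + β 2 * c := by
  rw [quad_eq_monomials]
  simp [apolar, coeff_monomial, Finsupp.ext_iff, Fin.forall_fin_two]

lemma lin_mul_lin (v w : Fin 2 → ℂ) :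
    lin v * lin w = quad (v 1 * w 1) (-(v 1 * w 0 + v 0 * w 1)) (v 0 * w 0) := by
  simp only [lin, quad, C_mul, C_add, C_neg]; ring

lemma apolar_lin_mul_lin (β : Fin 3 → ℂ) (v w : Fin 2 → ℂ) :
    apolar β (lin v * lin w) = polar β v w := by
  rw [lin_mul_lin, apolar_quad, polar]; ring

lemma polar_comm (β : Fin 3 → ℂ) (v w : Fin 2 → ℂ) : polar β v w = polar β w v := by
  unfold polar; ring

lemma exists_apolar {f g : Poly2} (hf : f.IsHomogeneous 2) (hg : g.IsHomogeneous 2) :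
    ∃ β : Fin 3 → ℂ, β ≠ 0 ∧ apolar β f = 0 ∧ apolar β g = 0 := by
  obtain ⟨a, b, c, rfl⟩ := exists_eq_quad hf
  obtain ⟨a', b', c', rfl⟩ := exists_eq_quad hg
  obtain ⟨β, hβ, h⟩ := (Matrix.exists_mulVec_eq_zero_iff
    (M := !![a, b, c; a', b', c'; a', b', c'])).2 (Matrix.det_zero_of_row_eq
      (i := 1) (j := 2) (by decide) rfl)
  refine ⟨β, hβ, ?_, ?_⟩
  · have := congrFun h 0
    simp [Matrix.mulVec, dotProduct, Fin.sum_univ_three] at this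
    rw [apolar_quad]; linear_combination this
  · have := congrFun h 1
    simp [Matrix.mulVec, dotProduct, Fin.sum_univ_three] at this
    rw [apolar_quad]; linear_combination this

/-- Two distinct quadratic forms killed by `β` span the kernel of `β`. -/
lemma Distinct.exists_combination {f g h : Poly2} (hfg : Distinct f g) (hf : f.IsHomogeneous 2)
    (hg : g.IsHomogeneous 2) (hh : h.IsHomogeneous 2) {β : Fin 3 → ℂ} (hβ : β ≠ 0)
    (af : apolar β f = 0) (ag : apolar β g = 0) (ah : apolar β h = 0) :
    ∃ s t : ℂ, h = C s * f + C t * g := by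
  obtain ⟨a, b, c, rfl⟩ := exists_eq_quad hf
  obtain ⟨a', b', c', rfl⟩ := exists_eq_quad hg
  obtain ⟨a'', b'', c'', rfl⟩ := exists_eq_quad hh
  rw [apolar_quad] at af ag ah
  have hdet := (Matrix.exists_mulVec_eq_zero_iff
    (M := !![a, b, c; a', b', c'; a'', b'', c''])).1 ⟨β, hβ, by
      funext i
      fin_cases i <;> simp [Matrix.mulVec, dotProduct, Fin.sum_univ_three]
      · linear_combination af
      · linear_combination ag
      · linear_combination ah⟩
  obtain ⟨r, hr, h⟩ := Matrix.exists_vecMul_eq_zero_iff.2 hdet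
  have e0 := congrFun h 0
  have e1 := congrFun h 1
  have e2 := congrFun h 2
  simp [Matrix.vecMul, dotProduct, Fin.sum_univ_three] at e0 e1 e2
  have e : C (r 0) * quad a b c + C (r 1) * quad a' b' c' + C (r 2) * quad a'' b'' c'' = 0 := by
    have e0' := congrArg (C : ℂ → Poly2) e0
    have e1' := congrArg (C : ℂ → Poly2) e1
    have e2' := congrArg (C : ℂ → Poly2) e2
    simp only [C_add, C_mul, C_0] at e0' e1' e2'
    unfold quad
    linear_combination X 0 ^ 2 * e0' + (X 0 * X 1) * e1' + X 1 ^ 2 * e2'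
  have hr2 : r 2 ≠ 0 := by
    intro hr2
    rw [hr2, C_0, zero_mul, add_zero] at e
    obtain ⟨h0, h1⟩ := distinct_iff.1 hfg _ _ e
    refine hr (funext fun i => ?_)
    fin_cases i
    · exact h0
    · exact h1
    · exact hr2
  refine ⟨-(r 0) / r 2, -(r 1) / r 2, ?_⟩
  have hC : (C (r 2) * C (r 2)⁻¹ : Poly2) = 1 := by rw [← C_mul, mul_inv_cancel₀ hr2, C_1]
  simp only [div_eq_mul_inv, C_mul, C_neg]
  linear_combination C (r 2)⁻¹ * e - quad a'' b'' c'' * hC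

/-! ### Representations and dependent triples of quadratic forms -/

/-- `s` is a representation `{f ^ 3, g ^ 3}` of `p` for which `β` kills the pencil spanned by `f`
and `g`. Up to a scalar, `β` and the pencil determine each other. -/
def RepWith (p : Poly2) (β : Fin 3 → ℂ) (s : Sym2 Poly2) : Prop :=
  ∃ f g : Poly2, f.IsHomogeneous 2 ∧ g.IsHomogeneous 2 ∧ Distinct f g ∧
    p = f ^ 3 + g ^ 3 ∧ s = s(f ^ 3, g ^ 3) ∧ apolar β f = 0 ∧ apolar β g = 0

lemma RepWith.mem {p : Poly2} {β : Fin 3 → ℂ} {s : Sym2 Poly2} (h : RepWith p β s) :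
    s ∈ representations p := by
  obtain ⟨f, g, hf, hg, hfg, hp, hs, -, -⟩ := h
  exact ⟨f, g, hf, hg, hfg, hp, hs⟩

lemma exists_repWith {p : Poly2} {s : Sym2 Poly2} (h : s ∈ representations p) :
    ∃ β, β ≠ 0 ∧ RepWith p β s := by
  obtain ⟨f, g, hf, hg, hfg, hp, hs⟩ := h
  obtain ⟨β, hβ, af, ag⟩ := exists_apolar hf hg
  exact ⟨β, hβ, f, g, hf, hg, hfg, hp, hs, af, ag⟩

/-- A representation is determined by its pencil. -/
lemma RepWith.unique {p : Poly2} {β : Fin 3 → ℂ} {s s' : Sym2 Poly2} (hβ : β ≠ 0)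
    (h : RepWith p β s) (h' : RepWith p β s') : s = s' := by
  obtain ⟨f, g, hf, hg, hfg, hp, rfl, af, ag⟩ := h
  obtain ⟨h, k, hh, hk, hhk, hp', rfl, ah, ak⟩ := h'
  obtain ⟨a, b, e1⟩ := hfg.exists_combination hf hg hh hβ af ag ah
  obtain ⟨c, d, e2⟩ := hfg.exists_combination hf hg hk hβ af ag ak
  exact hfg.cubes_unique hhk e1 e2 (hp.symm.trans hp')

lemma exists_cube_root : ∃ ω : ℂ, ω ^ 2 + ω + 1 = 0 := by
  simpa using exists_root_quadratic 1 1 (one_ne_zero (α := ℂ))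

lemma C_cube_root {ω : ℂ} (hω : ω ^ 2 + ω + 1 = 0) : (C ω : Poly2) ^ 2 + C ω + 1 = 0 := by
  rw [← C_pow, ← C_add, ← C_1, ← C_add, hω, C_0]

lemma sub_ne_zero_of_cube_root {ω : ℂ} (hω : ω ^ 2 + ω + 1 = 0) : ω ^ 2 - ω ≠ 0 := by
  intro h
  have h1 : ω = -(1 / 2) := by linear_combination (hω - h) / 2
  rw [h1] at hω
  norm_num at hω

lemma exists_eq_C_mul_of_cube_eq {f g : Poly2} (h : g ^ 3 = f ^ 3) : ∃ r : ℂ, g = C r * f := by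
  obtain ⟨ω, hω⟩ := exists_cube_root
  have hω' := C_cube_root hω
  have : (g - f) * ((g - C ω * f) * (g - C (ω ^ 2) * f)) = 0 := by
    rw [C_pow]
    linear_combination h + (C ω * f ^ 2 * g - f * g ^ 2 - C ω * f ^ 3 + f ^ 3) * hω'
  rcases mul_eq_zero.1 this with h | h
  · exact ⟨1, by rw [C_1]; linear_combination h⟩
  rcases mul_eq_zero.1 h with h | h
  · exact ⟨ω, by linear_combination h⟩
  · exact ⟨ω ^ 2, by linear_combination h⟩

/-- The pencil of a representation is determined by the pair of cubes. -/
lemma RepWith.apolar_eq_zero {p : Poly2} {β β' : Fin 3 → ℂ} {s : Sym2 Poly2} (hβ : β ≠ 0)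
    (h : RepWith p β s) (h' : RepWith p β' s) {q : Poly2} (hq : q.IsHomogeneous 2)
    (aq : apolar β q = 0) : apolar β' q = 0 := by
  obtain ⟨f, g, hf, hg, hfg, -, rfl, af, ag⟩ := h
  obtain ⟨h, k, hh, hk, hhk, -, hs, ah, ak⟩ := h'
  have key (f h : Poly2) (e : f ^ 3 = h ^ 3) (ah : apolar β' h = 0) : apolar β' f = 0 := by
    obtain ⟨r, rfl⟩ := exists_eq_C_mul_of_cube_eq e
    rw [apolar_C_mul, ah, mul_zero]
  have af' : apolar β' f = 0 ∧ apolar β' g = 0 := by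
    rcases Sym2.eq_iff.1 hs with ⟨e1, e2⟩ | ⟨e1, e2⟩
    · exact ⟨key _ _ e1 ah, key _ _ e2 ak⟩
    · exact ⟨key _ _ e1 ak, key _ _ e2 ah⟩
  obtain ⟨a, b, rfl⟩ := hfg.exists_combination hf hg hq hβ af ag aq
  rw [map_add, apolar_C_mul, apolar_C_mul, af'.1, af'.2, mul_zero, mul_zero, add_zero]

/-- A factorization `p = u v w` into quadratic forms of the pencil killed by `β`, normalized by
`u + v + w = 0`. With a primitive cube root of unity `ω`, it corresponds to the representation
`p = f ^ 3 + g ^ 3` where `u = f + g`, `v = ω f + ω² g`, `w = ω² f + ω g`. -/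
structure Triple (p : Poly2) (β : Fin 3 → ℂ) (u v w : Poly2) : Prop where
  hu : u.IsHomogeneous 2
  hv : v.IsHomogeneous 2
  distinct : Distinct u v
  sum : u + v + w = 0
  prod : p = u * v * w
  au : apolar β u = 0
  av : apolar β v = 0

section Triple

variable {p u v w : Poly2} {β : Fin 3 → ℂ}

lemma Triple.swap (h : Triple p β u v w) : Triple p β v u w :=
  ⟨h.hv, h.hu, h.distinct.symm, by linear_combination h.sum, by linear_combination h.prod,
    h.av, h.au⟩

lemma Triple.rotate (h : Triple p β u v w) : Triple p β v w u := by
  have hw : w = C (-1) * u + C (-1) * v := by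
    rw [C_neg, C_1]; linear_combination h.sum
  refine ⟨h.hv, ?_, ?_, by linear_combination h.sum, by linear_combination h.prod, h.av, ?_⟩
  · rw [hw]; exact (isHomogeneous_C_mul h.hu _).add (isHomogeneous_C_mul h.hv _)
  · have := h.distinct.combine (a := 0) (b := 1) (c := -1) (d := -1) (by norm_num)
    rwa [C_0, zero_mul, zero_add, C_1, one_mul, ← hw] at this
  · rw [hw, map_add, apolar_C_mul, apolar_C_mul, h.au, h.av]; ring

lemma Triple.prod_ne_zero (h : Triple p β u v w) : p ≠ 0 := by
  rw [h.prod]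
  exact mul_ne_zero (mul_ne_zero h.distinct.ne_zero h.distinct.symm.ne_zero)
    h.rotate.distinct.symm.ne_zero

/-- A zero of `p` is a zero of one of the three factors, which may be taken to be the first. -/
lemma Triple.exists_eval_eq_zero (h : Triple p β u v w) {a : Fin 2 → ℂ} (ha : eval a p = 0) :
    ∃ u v w, Triple p β u v w ∧ eval a u = 0 := by
  have := ha
  rw [h.prod, map_mul, map_mul, mul_eq_zero, mul_eq_zero] at this
  rcases this with (h1 | h1) | h1
  · exact ⟨u, v, w, h, h1⟩
  · exact ⟨v, w, u, h.rotate, h1⟩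
  · exact ⟨w, u, v, h.rotate.rotate, h1⟩

lemma Triple.eval_right (h : Triple p β u v w) {a : Fin 2 → ℂ} (hu : eval a u = 0)
    (hv : eval a v = 0) : eval a w = 0 := by
  have := congrArg (eval a) h.sum
  simpa [hu, hv] using this

/-- A common zero of two of the factors is a zero of the third, hence a triple zero of `p`. -/
lemma Triple.cube_dvd (h : Triple p β u v w) {a : Fin 2 → ℂ} (ha : a ≠ 0) (hu : eval a u = 0)
    (hv : eval a v = 0) : lin a ^ 3 ∣ p := by
  obtain ⟨b, hb⟩ := exists_eq_lin_mul_lin_of_eval_eq_zero h.hu ha hu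
  obtain ⟨c, hc⟩ := exists_eq_lin_mul_lin_of_eval_eq_zero h.hv ha hv
  obtain ⟨d, hd⟩ := exists_eq_lin_mul_lin_of_eval_eq_zero h.rotate.hv ha (h.eval_right hu hv)
  exact ⟨lin b * lin c * lin d, by rw [h.prod, hb, hc, hd]; ring⟩

/-- A double zero of `p` is a common zero of the pencil or a double zero of one factor. -/
lemma Triple.eq_sq_of_sq_dvd (h : Triple p β u v w) {a : Fin 2 → ℂ} (ha : a ≠ 0)
    (hu : eval a u = 0) (hv : eval a v ≠ 0) (hp : lin a ^ 2 ∣ p) :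
    ∃ t, u = C t * (lin a * lin a) := by
  have hw : eval a w ≠ 0 := fun hw => hv (h.rotate.rotate.eval_right hw hu)
  obtain ⟨b, hb⟩ := exists_eq_lin_mul_lin_of_eval_eq_zero h.hu ha hu
  obtain ⟨r, hr⟩ := hp
  have e : lin a * r = lin b * v * w :=
    mul_left_cancel₀ (lin_ne_zero ha) (by linear_combination h.prod - hr + (v * w) * hb)
  have hab := congrArg (eval a) e
  simp only [map_mul, eval_lin, wedge_self, zero_mul] at hab
  have : wedge a b = 0 := by simpa [hv, hw] using hab.symm
  obtain ⟨t, rfl⟩ := exists_smul_of_wedge_eq_zero ha this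
  exact ⟨t, by rw [hb, lin_smul]; ring⟩

/-- A triple zero of `p` is a common zero of the pencil. -/
lemma Triple.eval_eq_zero_of_cube_dvd (h : Triple p β u v w) {a : Fin 2 → ℂ} (ha : a ≠ 0)
    (hu : eval a u = 0) (hp : lin a ^ 3 ∣ p) : eval a v = 0 := by
  by_contra hv
  have hw : eval a w ≠ 0 := fun hw => hv (h.rotate.rotate.eval_right hw hu)
  obtain ⟨t, ht⟩ := h.eq_sq_of_sq_dvd ha hu hv ((pow_dvd_pow _ (by norm_num)).trans hp)
  obtain ⟨r, hr⟩ := hp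
  have e : lin a * r = C t * v * w :=
    mul_left_cancel₀ (pow_ne_zero 2 (lin_ne_zero ha))
      (by linear_combination h.prod - hr + (v * w) * ht)
  have ht0 : t ≠ 0 := by
    rintro rfl
    exact h.distinct.ne_zero (by rw [ht, C_0, zero_mul])
  have := congrArg (eval a) e
  simp only [map_mul, eval_lin, wedge_self, zero_mul, eval_C] at this
  exact mul_ne_zero (mul_ne_zero ht0 hv) hw this.symm

end Triple

lemma RepWith.exists_triple {p : Poly2} {β : Fin 3 → ℂ} {s : Sym2 Poly2} (h : RepWith p β s) :
    ∃ u v w, Triple p β u v w := by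
  obtain ⟨f, g, hf, hg, hfg, hp, -, af, ag⟩ := h
  obtain ⟨ω, hω⟩ := exists_cube_root
  have hω' := C_cube_root hω
  refine ⟨C 1 * f + C 1 * g, C ω * f + C (ω ^ 2) * g, C (ω ^ 2) * f + C ω * g,
    (isHomogeneous_C_mul hf _).add (isHomogeneous_C_mul hg _),
    (isHomogeneous_C_mul hf _).add (isHomogeneous_C_mul hg _), hfg.combine ?_, ?_, ?_, ?_, ?_⟩
  · have := sub_ne_zero_of_cube_root hω
    intro h; exact this (by linear_combination h)
  · rw [C_pow, C_1]; linear_combination (f + g) * hω'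
  · rw [hp, C_pow, C_1]
    linear_combination (-(f + g) * (f * g + (C ω - 1) * (f ^ 2 + C ω * f * g + g ^ 2))) * hω'
  · rw [map_add, apolar_C_mul, apolar_C_mul, af, ag]; ring
  · rw [map_add, apolar_C_mul, apolar_C_mul, af, ag]; ring

/-- Three pairwise distinct quadratic forms of one pencil with product `p` give a representation
of `p`. -/
lemma exists_repWith_of_eq_mul {p q₁ q₂ q₃ : Poly2} {β : Fin 3 → ℂ} (hβ : β ≠ 0)
    (h₁ : q₁.IsHomogeneous 2) (h₂ : q₂.IsHomogeneous 2) (h₃ : q₃.IsHomogeneous 2)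
    (a₁ : apolar β q₁ = 0) (a₂ : apolar β q₂ = 0) (a₃ : apolar β q₃ = 0)
    (h₁₂ : Distinct q₁ q₂) (h₁₃ : Distinct q₁ q₃) (h₂₃ : Distinct q₂ q₃)
    (hp : p = q₁ * q₂ * q₃) : ∃ s, RepWith p β s := by
  obtain ⟨ω, hω⟩ := exists_cube_root
  have hω' := C_cube_root hω
  obtain ⟨s, t, hst⟩ := h₁₂.exists_combination h₁ h₂ h₃ hβ a₁ a₂ a₃
  have hs : s ≠ 0 := by
    rintro rfl
    refine one_ne_zero (distinct_iff.1 h₂₃ (-t) 1 ?_).2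
    rw [hst, C_0, C_1, C_neg]; ring
  have ht : t ≠ 0 := by
    rintro rfl
    refine one_ne_zero (distinct_iff.1 h₁₃ (-s) 1 ?_).2
    rw [hst, C_0, C_1, C_neg]; ring
  -- rescale so that `u = l s q₁` and `v = l t q₂` satisfy `u v (-u - v) = p`
  obtain ⟨l, hl⟩ := IsAlgClosed.exists_pow_nat_eq (-(1 / (s * t))) (n := 3) (by norm_num)
  have hl0 : l ≠ 0 := by
    rintro rfl
    refine one_div_ne_zero (mul_ne_zero hs ht) ?_
    linear_combination hl
  have hl' : l ^ 3 * (s * t) = -1 := by rw [hl]; field_simp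
  have hl'' : (C l ^ 3 * (C s * C t) : Poly2) = -1 := by
    rw [← C_pow, ← C_mul, ← C_mul, hl', C_neg, C_1]
  have hC3 : (C 3⁻¹ * 3 : Poly2) = 1 := by
    rw [show (3 : Poly2) = C 3 from (map_ofNat C 3).symm, ← C_mul]; norm_num
  -- solve `u = f + g`, `v = ω f + ω² g` for `f` and `g`
  refine ⟨_, C (l * s * 3⁻¹ * (1 - ω)) * q₁ + C (l * t * 3⁻¹ * (-1 - 2 * ω)) * q₂,
    C (l * s * 3⁻¹ * (2 + ω)) * q₁ + C (l * t * 3⁻¹ * (1 + 2 * ω)) * q₂,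
    (isHomogeneous_C_mul h₁ _).add (isHomogeneous_C_mul h₂ _),
    (isHomogeneous_C_mul h₁ _).add (isHomogeneous_C_mul h₂ _), h₁₂.combine ?_, ?_, rfl, ?_, ?_⟩
  · have h2 : 1 + 2 * ω ≠ 0 := fun h => by
      have h1 : ω = -(1 / 2) := by linear_combination h / 2
      rw [h1] at hω
      norm_num at hω
    have h3 : l ^ 2 * (s * t) * (1 + 2 * ω) ≠ 0 :=
      mul_ne_zero (mul_ne_zero (pow_ne_zero 2 hl0) (mul_ne_zero hs ht)) h2
    intro h
    refine h3 ?_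
    linear_combination 3 * h
  · rw [hp, hst]
    simp only [C_mul, C_sub, C_add, C_neg, C_1, map_ofNat]
    linear_combination
      (27 * C 3⁻¹ ^ 3 * (q₁ * q₂ * (C s * q₁ + C t * q₂))) * hl''
      - (q₁ * q₂ * (C s * q₁ + C t * q₂) * (9 * C 3⁻¹ ^ 2 + 3 * C 3⁻¹ + 1)) * hC3
      - (9 * C 3⁻¹ ^ 3 * (C l * C s * q₁) * ((C l * C s * q₁) ^ 2
        + 4 * (C l * C s * q₁) * (C l * C t * q₂) + 4 * (C l * C t * q₂) ^ 2)) * hω'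
  · rw [map_add, apolar_C_mul, apolar_C_mul, a₁, a₂]; ring
  · rw [map_add, apolar_C_mul, apolar_C_mul, a₁, a₂]; ring

/-! ### Forms as products of linear forms -/

lemma isHomogeneous_prod_lin (w : Fin 6 → Fin 2 → ℂ) : (∏ i, lin (w i)).IsHomogeneous 6 := by
  simpa using IsHomogeneous.prod Finset.univ (fun i => lin (w i)) (fun _ => 1)
    (fun i _ => isHomogeneous_lin _)

lemma exists_eq_prod_lin {p : Poly2} {s : Sym2 Poly2} (h : s ∈ representations p) :
    ∃ w : Fin 6 → Fin 2 → ℂ, (∀ i, w i ≠ 0) ∧ p = ∏ i, lin (w i) := by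
  obtain ⟨β, -, hs⟩ := exists_repWith h
  obtain ⟨u, v, w, ht⟩ := hs.exists_triple
  obtain ⟨a₀, a₁, h0⟩ := exists_eq_lin_mul_lin ht.hu
  obtain ⟨a₂, a₃, h1⟩ := exists_eq_lin_mul_lin ht.hv
  obtain ⟨a₄, a₅, h2⟩ := exists_eq_lin_mul_lin ht.rotate.hv
  have hp : p = ∏ i, lin (![a₀, a₁, a₂, a₃, a₄, a₅] i) := by
    rw [Fin.prod_univ_six, ht.prod, h0, h1, h2]
    simp only [Matrix.cons_val]
    ring
  refine ⟨_, fun i hi => ht.prod_ne_zero ?_, hp⟩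
  rw [hp]
  exact Finset.prod_eq_zero (Finset.mem_univ i) (by rw [hi, lin_zero])

/-- If a quadratic factor of `∏ i, lin (w i)` vanishes at `w i`, then its other zero is another
of the points `w j`. -/
lemma exists_partner {w : Fin 6 → Fin 2 → ℂ} (hw : ∀ i, w i ≠ 0) {u r : Poly2}
    (hu : u.IsHomogeneous 2) (hp : ∏ i, lin (w i) = u * r) {i : Fin 6} (hi : eval (w i) u = 0) :
    ∃ j, j ≠ i ∧ ∃ t, t ≠ 0 ∧ u = C t * (lin (w i) * lin (w j)) := by
  obtain ⟨a, ha⟩ := exists_eq_lin_mul_lin_of_eval_eq_zero hu (hw i) hi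
  have hp0 : ∏ i, lin (w i) ≠ 0 := Finset.prod_ne_zero_iff.2 fun i _ => lin_ne_zero (hw i)
  have hu0 : u ≠ 0 := by rintro rfl; exact hp0 (by rw [hp, zero_mul])
  have e : ∏ j ∈ Finset.univ.erase i, lin (w j) = lin a * r := by
    refine mul_left_cancel₀ (lin_ne_zero (hw i)) ?_
    rw [Finset.mul_prod_erase _ (fun j => lin (w j)) (Finset.mem_univ i), hp, ha]; ring
  have := congrArg (eval a) e
  rw [map_prod, map_mul, eval_lin, wedge_self, zero_mul, Finset.prod_eq_zero_iff] at this
  obtain ⟨j, hj, hja⟩ := this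
  rw [eval_lin, wedge_swap, neg_eq_zero] at hja
  obtain ⟨t, rfl⟩ := exists_smul_of_wedge_eq_zero (hw j) hja
  refine ⟨j, Finset.ne_of_mem_erase hj, t, ?_, by rw [ha, lin_smul]; ring⟩
  rintro rfl
  exact hu0 (by rw [ha, zero_smul, lin_zero, mul_zero])

/-- If the points `w i` are pairwise distinct, then `∏ i, lin (w i)` has no double zero. -/
lemma not_sq_dvd {w : Fin 6 → Fin 2 → ℂ} (hw : ∀ i j, i ≠ j → wedge (w i) (w j) ≠ 0)
    {a : Fin 2 → ℂ} (ha : a ≠ 0) : ¬ lin a ^ 2 ∣ ∏ i, lin (w i) := by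
  have hw0 (i) : w i ≠ 0 := ne_zero_of_wedge (hw i (i + 1) (by simp))
  rintro ⟨r, hr⟩
  have := congrArg (eval a) hr
  rw [map_prod, map_mul, map_pow, eval_lin, wedge_self, zero_pow two_ne_zero, zero_mul,
    Finset.prod_eq_zero_iff] at this
  obtain ⟨i, -, hi⟩ := this
  rw [eval_lin] at hi
  obtain ⟨t, ht⟩ := exists_smul_of_wedge_eq_zero ha hi
  have hu : eval (w i) (lin a ^ 2) = 0 := by
    rw [map_pow, eval_lin, wedge_swap, hi]; norm_num
  obtain ⟨j, hij, t', ht', e⟩ := exists_partner hw0 (u := lin a ^ 2)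
    ((isHomogeneous_lin a).pow 2) hr hu
  have := congrArg (eval a) e
  have hj : eval (w j) (lin a ^ 2) = 0 := by
    rw [e]; simp [eval_lin, wedge_self]
  rw [map_pow, eval_lin] at hj
  obtain ⟨r', hr'⟩ := exists_smul_of_wedge_eq_zero (hw0 j) (pow_eq_zero_iff two_ne_zero |>.1 hj)
  refine hw i j hij.symm ?_
  rw [ht, hr']
  simp only [wedge, Pi.smul_apply, smul_eq_mul]; ring

/-! ### Pairings of six elements -/

/-- The fifteen fixed-point-free involutions of a set of six elements, that is, the fifteen ways to
split it into three pairs. -/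
def pairing : Fin 15 → Fin 6 → Fin 6 :=
  ![![1, 0, 3, 2, 5, 4], ![1, 0, 4, 5, 2, 3], ![1, 0, 5, 4, 3, 2],
    ![2, 3, 0, 1, 5, 4], ![2, 4, 0, 5, 1, 3], ![2, 5, 0, 4, 3, 1],
    ![3, 2, 1, 0, 5, 4], ![3, 4, 5, 0, 1, 2], ![3, 5, 4, 0, 2, 1],
    ![4, 2, 1, 5, 0, 3], ![4, 3, 5, 1, 0, 2], ![4, 5, 3, 2, 0, 1],
    ![5, 2, 1, 4, 3, 0], ![5, 3, 4, 1, 2, 0], ![5, 4, 3, 2, 1, 0]]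

/-- One element from each of the three pairs of a pairing. -/
def pairingRep : Fin 15 → Fin 3 → Fin 6 :=
  ![![0, 2, 4], ![0, 2, 3], ![0, 2, 3], ![0, 1, 4], ![0, 1, 3],
    ![0, 1, 3], ![0, 1, 4], ![0, 1, 2], ![0, 1, 2], ![0, 1, 3],
    ![0, 1, 2], ![0, 1, 2], ![0, 1, 3], ![0, 1, 2], ![0, 1, 2]]

set_option synthInstance.maxSize 2000 in
set_option synthInstance.maxHeartbeats 400000 in
lemma exists_pairing_eq (e : Fin 6 → Fin 6) (h₁ : ∀ i, e i ≠ i) (h₂ : ∀ i, e (e i) = i) :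
    ∃ k, ∀ i, e i = pairing k i := by
  have hs (i j : Fin 6) : e i = j ↔ e j = i :=
    ⟨fun h => by rw [← h, h₂], fun h => by rw [← h, h₂]⟩
  have key : ∀ a : Fin 6, a ≠ 0 → ∀ b : Fin 6, b ≠ 1 → (b = 0 ↔ a = 1) →
      ∀ c : Fin 6, c ≠ 2 → (c = 0 ↔ a = 2) → (c = 1 ↔ b = 2) →
      ∀ d : Fin 6, d ≠ 3 → (d = 0 ↔ a = 3) → (d = 1 ↔ b = 3) → (d = 2 ↔ c = 3) →
      ∀ f : Fin 6, f ≠ 4 → (f = 0 ↔ a = 4) → (f = 1 ↔ b = 4) → (f = 2 ↔ c = 4) →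
        (f = 3 ↔ d = 4) →
      ∀ g : Fin 6, g ≠ 5 → (g = 0 ↔ a = 5) → (g = 1 ↔ b = 5) → (g = 2 ↔ c = 5) →
        (g = 3 ↔ d = 5) → (g = 4 ↔ f = 5) →
      ∃ k, a = pairing k 0 ∧ b = pairing k 1 ∧ c = pairing k 2 ∧ d = pairing k 3 ∧
        f = pairing k 4 ∧ g = pairing k 5 := by
    decide +kernel
  obtain ⟨k, h⟩ := key (e 0) (h₁ 0) (e 1) (h₁ 1) (hs _ _) (e 2) (h₁ 2) (hs _ _) (hs _ _)
    (e 3) (h₁ 3) (hs _ _) (hs _ _) (hs _ _) (e 4) (h₁ 4) (hs _ _) (hs _ _) (hs _ _) (hs _ _)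
    (e 5) (h₁ 5) (hs _ _) (hs _ _) (hs _ _) (hs _ _) (hs _ _)
  refine ⟨k, fun i => ?_⟩
  fin_cases i
  exacts [h.1, h.2.1, h.2.2.1, h.2.2.2.1, h.2.2.2.2.1, h.2.2.2.2.2]

lemma pairing_injective : ∀ k k', (∀ i, pairing k i = pairing k' i) → k = k' := by
  decide +kernel

/-- Among any four pairings, two have no pair in common: otherwise all four would contain one
common pair, but only three pairings do. -/
lemma exists_disjoint_pairings : ∀ a b c d : Fin 15, a ≠ b → a ≠ c → a ≠ d → b ≠ c → b ≠ d →
    c ≠ d → (∀ i, pairing a i ≠ pairing b i) ∨ (∀ i, pairing a i ≠ pairing c i) ∨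
      (∀ i, pairing a i ≠ pairing d i) ∨ (∀ i, pairing b i ≠ pairing c i) ∨
      (∀ i, pairing b i ≠ pairing d i) ∨ (∀ i, pairing c i ≠ pairing d i) := by
  have key : ∀ a b : Fin 15, a ≠ b → (∀ i, pairing a i ≠ pairing b i) ∨
      ∀ c, a ≠ c → b ≠ c → (∀ i, pairing a i ≠ pairing c i) ∨ (∀ i, pairing b i ≠ pairing c i) ∨
      ∀ d, a ≠ d → b ≠ d → c ≠ d → (∀ i, pairing a i ≠ pairing d i) ∨
        (∀ i, pairing b i ≠ pairing d i) ∨ (∀ i, pairing c i ≠ pairing d i) := by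
    decide +kernel
  intro a b c d h1 h2 h3 h4 h5 h6
  rcases key a b h1 with h | h
  · exact Or.inl h
  rcases h c h2 h4 with h | h | h
  · exact Or.inr (Or.inl h)
  · exact Or.inr (Or.inr (Or.inr (Or.inl h)))
  rcases h d h3 h5 h6 with h | h | h
  · exact Or.inr (Or.inr (Or.inl h))
  · exact Or.inr (Or.inr (Or.inr (Or.inr (Or.inl h))))
  · exact Or.inr (Or.inr (Or.inr (Or.inr (Or.inr h))))

/-- The union of two disjoint pairings is a hexagon. -/
lemma exists_hexagon : ∀ k k' : Fin 15, (∀ i, pairing k i ≠ pairing k' i) →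
    ∃ n : Fin 6 → Fin 6, Function.Injective n ∧
      pairing k (n 0) = n 1 ∧ pairing k (n 2) = n 3 ∧ pairing k (n 4) = n 5 ∧
      pairing k' (n 1) = n 2 ∧ pairing k' (n 3) = n 4 ∧ pairing k' (n 5) = n 0 := by
  have key : ∀ k k' : Fin 15, (∀ i, pairing k i ≠ pairing k' i) →
      ∃ a b c d f, (∀ i j, ![0, a, b, c, d, f] i = ![0, a, b, c, d, f] j → i = j) ∧
      pairing k 0 = a ∧ pairing k b = c ∧ pairing k d = f ∧
      pairing k' a = b ∧ pairing k' c = d ∧ pairing k' f = 0 := by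
    intro k k' h
    refine ⟨pairing k 0, pairing k' (pairing k 0), pairing k (pairing k' (pairing k 0)),
      pairing k' (pairing k (pairing k' (pairing k 0))),
      pairing k (pairing k' (pairing k (pairing k' (pairing k 0)))), ?_⟩
    revert k k'
    decide +kernel
  intro k k' h
  obtain ⟨a, b, c, d, f, h0, h1⟩ := key k k' h
  exact ⟨![0, a, b, c, d, f], h0, h1⟩

lemma pairingRep_ne : ∀ k i j, i ≠ j → pairingRep k i ≠ pairingRep k j ∧
    pairingRep k i ≠ pairing k (pairingRep k j) ∧
    pairing k (pairingRep k i) ≠ pairing k (pairingRep k j) := by decide +kernel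

lemma forall_of_pairingRep : ∀ k i, ∃ j, i = pairingRep k j ∨ i = pairing k (pairingRep k j) := by
  decide +kernel

lemma pairing_pairing : ∀ k i, pairing k (pairing k i) = i := by decide +kernel

lemma prod_pairing {M : Type*} [CommMonoid M] (f : Fin 6 → M) (k : Fin 15) :
    ∏ i, f i = ∏ j, (f (pairingRep k j) * f (pairing k (pairingRep k j))) := by
  rw [Finset.prod_mul_distrib, ← Fintype.prod_sumElim]
  have h : ∀ k, Function.Bijective
      (Sum.elim (fun j => pairingRep k j) (fun j => pairing k (pairingRep k j))) := by
    decide +kernel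
  rw [← (Equiv.ofBijective _ (h k)).prod_comp f]
  refine Finset.prod_congr rfl fun x _ => ?_
  rcases x with x | x <;> rfl

/-! ### Counting representations -/

lemma encard_le_of_relation {α ι : Type*} {S : Set α} {F : Set ι} (R : ι → α → Prop)
    (h : ∀ s ∈ S, ∃ k ∈ F, R k s) (hu : ∀ k s s', R k s → R k s' → s = s') :
    S.encard ≤ F.encard := by
  have : ∀ s : S, ∃ k : F, R k s := fun s => by
    obtain ⟨k, hk, hR⟩ := h s s.2
    exact ⟨⟨k, hk⟩, hR⟩
  choose φ hφ using this
  exact Function.Embedding.encard_le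
    ⟨φ, fun s s' e => Subtype.ext (hu (φ s) s s' (hφ s) (by rw [e]; exact hφ s'))⟩

/-- A pencil is determined by two of its members. -/
lemma RepWith.of_distinct {p q₁ q₂ : Poly2} {β β' : Fin 3 → ℂ} {s : Sym2 Poly2}
    (h : RepWith p β' s) (hβ' : β' ≠ 0) (h₁₂ : Distinct q₁ q₂) (h₁ : q₁.IsHomogeneous 2)
    (h₂ : q₂.IsHomogeneous 2) (a₁ : apolar β q₁ = 0) (a₂ : apolar β q₂ = 0)
    (a₁' : apolar β' q₁ = 0) (a₂' : apolar β' q₂ = 0) : RepWith p β s := by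
  obtain ⟨f, g, hf, hg, hfg, hp, hs, af, ag⟩ := h
  have key {q : Poly2} (hq : q.IsHomogeneous 2) (aq : apolar β' q = 0) : apolar β q = 0 := by
    obtain ⟨a, b, rfl⟩ := h₁₂.exists_combination h₁ h₂ hq hβ' a₁' a₂' aq
    rw [map_add, apolar_C_mul, apolar_C_mul, a₁, a₂, mul_zero, mul_zero, add_zero]
  exact ⟨f, g, hf, hg, hfg, hp, hs, key hf af, key hg ag⟩

lemma distinct_lin_mul_lin {a b c d : Fin 2 → ℂ} (hac : wedge a c ≠ 0) (had : wedge a d ≠ 0)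
    (hcb : wedge c b ≠ 0) : Distinct (lin a * lin b) (lin c * lin d) := by
  rw [distinct_iff]
  intro s t h
  have h1 := congrArg (eval a) h
  have h2 := congrArg (eval c) h
  simp only [map_add, map_mul, eval_C, eval_lin, wedge_self, map_zero, zero_mul, mul_zero,
    zero_add, add_zero, mul_eq_zero, hac, had, hcb, or_false] at h1 h2
  refine ⟨h2.resolve_right fun h => hac ?_, h1⟩
  rw [wedge_swap, h, neg_zero]

/-- If the symmetric bilinear form of `β` is degenerate, then `apolar β` is evaluation at the
point `a` of its radical, up to a scalar. -/
lemma eval_eq_zero_of_polar {β : Fin 3 → ℂ} (hβ : β ≠ 0) {a b c : Fin 2 → ℂ} (ha : a ≠ 0)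
    (hbc : wedge b c ≠ 0) (hb : polar β a b = 0) (hc : polar β a c = 0) {q : Poly2}
    (hq : q.IsHomogeneous 2) (aq : apolar β q = 0) : eval a q = 0 := by
  unfold polar at hb hc
  unfold wedge at hbc
  have e0 : β 0 * a 1 = β 1 * a 0 := by
    refine sub_eq_zero.1 ((mul_eq_zero.1 (?_ : _ * (b 0 * c 1 - b 1 * c 0) = 0)).resolve_right hbc)
    linear_combination b 0 * hc - c 0 * hb
  have e1 : β 1 * a 1 = β 2 * a 0 := by
    refine sub_eq_zero.1 ((mul_eq_zero.1 (?_ : _ * (b 0 * c 1 - b 1 * c 0) = 0)).resolve_right hbc)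
    linear_combination b 1 * hc - c 1 * hb
  obtain ⟨x, y, z, rfl⟩ := exists_eq_quad hq
  rw [apolar_quad] at aq
  rw [eval_quad]
  by_cases h0 : a 0 = 0
  · have h1 : a 1 ≠ 0 := fun h1 => ha (funext (Fin.forall_fin_two.2 ⟨h0, h1⟩))
    have b0 : β 0 = 0 := by simpa [h0, h1] using e0
    have b1 : β 1 = 0 := by simpa [h0, h1] using e1
    have b2 : β 2 ≠ 0 := fun b2 => hβ (funext (by
      intro i; fin_cases i; exacts [b0, b1, b2]))
    have hz : z = 0 := by simpa [b0, b1, b2] using aq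
    rw [h0, hz]; ring
  · have b0 : β 0 ≠ 0 := fun b0 => by
      have b1 : β 1 = 0 := by simpa [b0, h0] using e0
      have b2 : β 2 = 0 := by simpa [b1, h0] using e1
      exact hβ (funext (by intro i; fin_cases i; exacts [b0, b1, b2]))
    refine (mul_eq_zero.1 (?_ : β 0 * _ = 0)).resolve_left b0
    linear_combination a 0 ^ 2 * aq + (y * a 0 + z * a 1) * e0 + z * a 0 * e1

/-- The pairing `k` of the points `w i` is involutive: some nonzero symmetric bilinear form makes
the two points of each pair orthogonal. For distinct points this says that some involution of the
projective line interchanges the two points of each pair. -/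
def Involutive (w : Fin 6 → Fin 2 → ℂ) (k : Fin 15) : Prop :=
  ∃ β : Fin 3 → ℂ, β ≠ 0 ∧ ∀ i, polar β (w i) (w (pairing k i)) = 0

section DistinctZeros

variable {w : Fin 6 → Fin 2 → ℂ}

/-- For distinct zeros, the form of a pencil is nondegenerate: otherwise all forms of the pencil
would have a common zero, a triple zero of the sextic. So a zero is orthogonal to at most one
other zero. -/
lemma RepWith.eq_of_polar {β : Fin 3 → ℂ} {s : Sym2 Poly2}
    (hw : ∀ i j, i ≠ j → wedge (w i) (w j) ≠ 0) (h : RepWith (∏ i, lin (w i)) β s) (hβ : β ≠ 0)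
    {i j k : Fin 6} (hij : polar β (w i) (w j) = 0) (hik : polar β (w i) (w k) = 0) : j = k := by
  by_contra hjk
  have hi : w i ≠ 0 := ne_zero_of_wedge (hw i (i + 1) (by simp))
  obtain ⟨u, v, r, ht⟩ := h.exists_triple
  have key {q : Poly2} (hq : q.IsHomogeneous 2) (aq : apolar β q = 0) : eval (w i) q = 0 :=
    eval_eq_zero_of_polar hβ hi (hw j k hjk) hij hik hq aq
  exact not_sq_dvd hw hi ((pow_dvd_pow _ (by norm_num)).trans
    (ht.cube_dvd hi (key ht.hu ht.au) (key ht.hv ht.av)))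

/-- Each zero is paired with the other zero of the quadratic factor that it belongs to. -/
lemma RepWith.exists_pairing {β : Fin 3 → ℂ} {s : Sym2 Poly2}
    (hw : ∀ i j, i ≠ j → wedge (w i) (w j) ≠ 0) (h : RepWith (∏ i, lin (w i)) β s) (hβ : β ≠ 0) :
    ∃ k, ∀ i, polar β (w i) (w (pairing k i)) = 0 := by
  have hw0 (i) : w i ≠ 0 := ne_zero_of_wedge (hw i (i + 1) (by simp))
  obtain ⟨u, v, r, ht⟩ := h.exists_triple
  have : ∀ i, ∃ j, j ≠ i ∧ polar β (w i) (w j) = 0 := by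
    intro i
    obtain ⟨u', v', r', ht', hi⟩ := ht.exists_eval_eq_zero (a := w i) (by
      rw [map_prod]
      exact Finset.prod_eq_zero (Finset.mem_univ i) (by rw [eval_lin, wedge_self]))
    obtain ⟨j, hj, t, ht0, e⟩ := exists_partner hw0 ht'.hu (ht'.prod.trans (mul_assoc _ _ _)) hi
    refine ⟨j, hj, ?_⟩
    have := ht'.au
    rw [e, apolar_C_mul, apolar_lin_mul_lin] at this
    exact (mul_eq_zero.1 this).resolve_left ht0
  choose e he he' using this
  obtain ⟨k, hk⟩ := exists_pairing_eq e he fun i =>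
    h.eq_of_polar hw hβ (he' (e i)) (by rw [polar_comm]; exact he' i)
  exact ⟨k, fun i => by rw [← hk]; exact he' i⟩

lemma distinct_of_pairing (hw : ∀ i j, i ≠ j → wedge (w i) (w j) ≠ 0) (k : Fin 15) {i j : Fin 3}
    (hij : i ≠ j) : Distinct (lin (w (pairingRep k i)) * lin (w (pairing k (pairingRep k i))))
      (lin (w (pairingRep k j)) * lin (w (pairing k (pairingRep k j)))) :=
  distinct_lin_mul_lin (hw _ _ (pairingRep_ne k i j hij).1) (hw _ _ (pairingRep_ne k i j hij).2.1)
    (hw _ _ (pairingRep_ne k j i hij.symm).2.1)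

/-- If the six zeros of `p` are distinct, its representations correspond to the involutive
pairings of the zeros. -/
lemma N_prod_lin (hw : ∀ i j, i ≠ j → wedge (w i) (w j) ≠ 0) :
    N (∏ i, lin (w i)) = {k | Involutive w k}.encard := by
  have hq (k : Fin 15) (j : Fin 3) : (lin (w (pairingRep k j)) *
      lin (w (pairing k (pairingRep k j)))).IsHomogeneous 2 := isHomogeneous_lin_mul_lin _ _
  set R : Fin 15 → Sym2 Poly2 → Prop := fun k s =>
    ∃ β, β ≠ 0 ∧ RepWith (∏ i, lin (w i)) β s ∧ ∀ i, polar β (w i) (w (pairing k i)) = 0 with hR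
  refine le_antisymm (encard_le_of_relation R ?_ ?_)
    (encard_le_of_relation (fun s k => R k s) ?_ ?_)
  · intro s hs
    obtain ⟨β, hβ, h⟩ := exists_repWith hs
    obtain ⟨k, hk⟩ := h.exists_pairing hw hβ
    exact ⟨k, ⟨β, hβ, hk⟩, β, hβ, h, hk⟩
  · rintro k s s' ⟨β, hβ, h, hk⟩ ⟨β', hβ', h', hk'⟩
    refine h.unique hβ (h'.of_distinct hβ' (distinct_of_pairing hw k (zero_ne_one (α := Fin 3)))
      (hq _ _) (hq _ _) ?_ ?_ ?_ ?_) <;> rw [apolar_lin_mul_lin]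
    exacts [hk _, hk _, hk' _, hk' _]
  · rintro k ⟨β, hβ, hk⟩
    have hd {i j : Fin 3} (hij : i ≠ j) := distinct_of_pairing hw k hij
    obtain ⟨s, hs⟩ := exists_repWith_of_eq_mul hβ (hq k 0) (hq k 1) (hq k 2)
      (by rw [apolar_lin_mul_lin, hk]) (by rw [apolar_lin_mul_lin, hk])
      (by rw [apolar_lin_mul_lin, hk]) (hd (by decide)) (hd (by decide)) (hd (by decide))
      ((prod_pairing (fun i => lin (w i)) k).trans (Fin.prod_univ_three _))
    exact ⟨s, hs.mem, β, hβ, hs, hk⟩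
  · rintro s k k' ⟨β, hβ, h, hk⟩ ⟨β', hβ', h', hk'⟩
    refine pairing_injective k k' fun i => h'.eq_of_polar hw hβ' (i := i) ?_ (hk' i)
    rw [← apolar_lin_mul_lin]
    exact h.apolar_eq_zero hβ h' (isHomogeneous_lin_mul_lin _ _)
      (by rw [apolar_lin_mul_lin, hk])

end DistinctZeros

/-! ### Sextics with a multiple zero -/

/-- A triple zero is a common zero of every pencil, and so determines the pencil. -/
lemma N_le_one_of_cube_dvd {p : Poly2} {a : Fin 2 → ℂ} (ha : a ≠ 0) (hp : lin a ^ 3 ∣ p) :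
    N p ≤ 1 := by
  refine Set.encard_le_one_iff.2 fun s s' hs hs' => ?_
  set γ : Fin 3 → ℂ := ![a 0 ^ 2, a 0 * a 1, a 1 ^ 2] with hγ
  have hγ0 : γ ≠ 0 := fun h => ha (funext (Fin.forall_fin_two.2
    ⟨by simpa [hγ] using congrFun h 0, by simpa [hγ] using congrFun h 2⟩))
  -- both pencils consist of the quadratic forms vanishing at `a`
  have key {s : Sym2 Poly2} (hs : s ∈ representations p) : RepWith p γ s := by
    obtain ⟨β, hβ, h⟩ := exists_repWith hs
    obtain ⟨u₀, v₀, r₀, h₀⟩ := h.exists_triple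
    obtain ⟨u, v, r, ht, hu⟩ := h₀.exists_eval_eq_zero (a := a) (by
      obtain ⟨r, rfl⟩ := hp
      simp [eval_lin, wedge_self])
    have hv := ht.eval_eq_zero_of_cube_dvd ha hu hp
    have e {q : Poly2} (hq : q.IsHomogeneous 2) (hq' : eval a q = 0) : apolar γ q = 0 := by
      obtain ⟨x, y, z, rfl⟩ := exists_eq_quad hq
      rw [eval_quad] at hq'
      rw [apolar_quad, ← hq']
      simp only [hγ, Matrix.cons_val]
      ring
    exact h.of_distinct hβ ht.distinct ht.hu ht.hv (e ht.hu hu) (e ht.hv hv) ht.au ht.av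
  exact (key hs).unique hγ0 (key hs')

/-- A sextic with a multiple zero has at most three representations: a zero that is exactly double
forms a quadratic factor by itself, and the other four zeros are split into two pairs. -/
lemma N_le_three_of_sq_dvd {w : Fin 6 → Fin 2 → ℂ} (hw : ∀ i, w i ≠ 0) {i j : Fin 6} (hij : i ≠ j)
    (h : wedge (w i) (w j) = 0) : N (∏ i, lin (w i)) ≤ 3 := by
  by_cases h3 : lin (w i) ^ 3 ∣ ∏ i, lin (w i)
  · exact (N_le_one_of_cube_dvd (hw i) h3).trans (by norm_num)
  obtain ⟨t, ht⟩ := exists_smul_of_wedge_eq_zero (hw i) h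
  have hprod : ∏ k, lin (w k) =
      lin (w i) * (lin (w j) * ∏ k ∈ (Finset.univ.erase i).erase j, lin (w k)) := by
    rw [Finset.mul_prod_erase _ (fun k => lin (w k))
      (Finset.mem_erase.2 ⟨hij.symm, Finset.mem_univ j⟩),
      Finset.mul_prod_erase _ (fun k => lin (w k)) (Finset.mem_univ i)]
  have h2 : lin (w i) ^ 2 ∣ ∏ i, lin (w i) := by
    refine ⟨C t * ∏ k ∈ (Finset.univ.erase i).erase j, lin (w k), ?_⟩
    rw [hprod, ht, lin_smul]; ring
  have hne : ∀ k, k ≠ i → k ≠ j → wedge (w i) (w k) ≠ 0 := by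
    intro k hki hkj hk
    obtain ⟨t', ht'⟩ := exists_smul_of_wedge_eq_zero (hw i) hk
    refine h3 ⟨C t * C t' * ∏ k ∈ ((Finset.univ.erase i).erase j).erase k, lin (w k), ?_⟩
    rw [hprod, ← Finset.mul_prod_erase _ (fun k => lin (w k))
      (Finset.mem_erase.2 ⟨hkj, Finset.mem_erase.2 ⟨hki, Finset.mem_univ k⟩⟩), ht, lin_smul, ht',
      lin_smul]
    ring
  obtain ⟨m, hmi, hmj⟩ : ∃ m : Fin 6, m ≠ i ∧ m ≠ j := by
    have : ∀ i j : Fin 6, ∃ m : Fin 6, m ≠ i ∧ m ≠ j := by decide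
    exact this i j
  -- the double zero is paired with itself, so the partner of `w m` is one of three points
  set F : Finset (Fin 6) := Finset.univ.filter fun k => k ≠ i ∧ k ≠ j ∧ k ≠ m with hF
  have hcard : F.card = 3 := by
    have : ∀ i j m : Fin 6, i ≠ j → m ≠ i → m ≠ j →
        (Finset.univ.filter fun k : Fin 6 => k ≠ i ∧ k ≠ j ∧ k ≠ m).card = 3 := by decide
    exact this i j m hij hmi hmj
  have h3' : (3 : ℕ∞) = (F : Set (Fin 6)).encard := by
    rw [Set.encard_coe_eq_coe_finsetCard, hcard]; rfl
  rw [h3']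
  refine encard_le_of_relation (fun k s => k ∈ F ∧ ∃ β, β ≠ 0 ∧ RepWith (∏ i, lin (w i)) β s ∧
    polar β (w i) (w i) = 0 ∧ polar β (w m) (w k) = 0) ?_ ?_
  · intro s hs
    obtain ⟨β, hβ, hr⟩ := exists_repWith hs
    obtain ⟨u₀, v₀, r₀, h₀⟩ := hr.exists_triple
    have heval (k) : eval (w k) (∏ i, lin (w i)) = 0 := by
      rw [map_prod]
      exact Finset.prod_eq_zero (Finset.mem_univ k) (by rw [eval_lin, wedge_self])
    obtain ⟨u, v, r, hT, hu⟩ := h₀.exists_eval_eq_zero (heval i)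
    have hv : eval (w i) v ≠ 0 := fun hv => h3 (hT.cube_dvd (hw i) hu hv)
    obtain ⟨t', ht'⟩ := hT.eq_sq_of_sq_dvd (hw i) hu hv h2
    have ht0 : t' ≠ 0 := by
      rintro rfl
      exact hT.distinct.ne_zero (by rw [ht', C_0, zero_mul])
    have hum : eval (w m) u ≠ 0 := by
      rw [ht', map_mul, map_mul, eval_C, eval_lin, wedge_swap]
      have := hne m hmi hmj
      exact mul_ne_zero ht0 (mul_ne_zero (neg_ne_zero.2 this) (neg_ne_zero.2 this))
    obtain ⟨v', r', hT', hv', hvm⟩ : ∃ v' r', Triple (∏ i, lin (w i)) β v' u r' ∧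
        eval (w i) v' ≠ 0 ∧ eval (w m) v' = 0 := by
      have := heval m
      rw [hT.prod, map_mul, map_mul] at this
      rcases mul_eq_zero.1 this with h | h
      · exact ⟨v, r, hT.swap, hv, (mul_eq_zero.1 h).resolve_left hum⟩
      · exact ⟨r, v, hT.rotate.rotate,
          fun hr => hv (hT.rotate.rotate.eval_right hr hu), h⟩
    obtain ⟨k, hkm, c, hc, e⟩ := exists_partner hw hT'.hu (hT'.prod.trans (mul_assoc _ _ _)) hvm
    have hik : wedge (w i) (w k) ≠ 0 := by
      intro h
      rw [e, map_mul, map_mul, eval_lin, eval_lin, h, mul_zero, mul_zero] at hv'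
      exact hv' rfl
    have hkF : k ∈ F := by
      simp only [hF, Finset.mem_filter, Finset.mem_univ, true_and]
      refine ⟨?_, ?_, hkm⟩
      · rintro rfl; exact hik (wedge_self _)
      · rintro rfl; exact hik h
    refine ⟨k, hkF, hkF, β, hβ, hr, ?_, ?_⟩
    · have := hT.au
      rw [ht', apolar_C_mul, apolar_lin_mul_lin] at this
      exact (mul_eq_zero.1 this).resolve_left ht0
    · have := hT'.au
      rw [e, apolar_C_mul, apolar_lin_mul_lin] at this
      exact (mul_eq_zero.1 this).resolve_left hc
  · rintro k s s' ⟨hk, β, hβ, hr, h1, h2⟩ ⟨-, β', hβ', hr', h1', h2'⟩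
    simp only [hF, Finset.mem_filter, Finset.mem_univ, true_and] at hk
    have hm := hne m hmi hmj
    refine hr.unique hβ (hr'.of_distinct hβ'
      (distinct_lin_mul_lin hm (hne k hk.1 hk.2.1) ?_)
      (isHomogeneous_lin_mul_lin (w i) (w i)) (isHomogeneous_lin_mul_lin (w m) (w k)) ?_ ?_ ?_ ?_)
    · rw [wedge_swap]; exact neg_ne_zero.2 hm
    all_goals rw [apolar_lin_mul_lin]; assumption

/-- A sextic with more than three representations has six distinct zeros. -/
lemma exists_prod_lin_of_three_lt {p : Poly2} (h : 3 < N p) : ∃ w : Fin 6 → Fin 2 → ℂ,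
    (∀ i j, i ≠ j → wedge (w i) (w j) ≠ 0) ∧ p = ∏ i, lin (w i) := by
  obtain ⟨s, hs⟩ : (representations p).Nonempty := by
    rw [Set.nonempty_iff_ne_empty]
    intro h0
    rw [N, h0, Set.encard_empty] at h
    exact absurd h (by simp)
  obtain ⟨w, hw, rfl⟩ := exists_eq_prod_lin hs
  exact ⟨w, fun i j hij h0 => absurd h (not_lt.2 (N_le_three_of_sq_dvd hw hij h0)), rfl⟩

/-! ### Normal form of two disjoint involutive pairings -/

/-- The points `1, ω, ω², c, ω c, ω² c` of the projective line. -/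
noncomputable def hexad (ω c : ℂ) : Fin 6 → Fin 2 → ℂ :=
  ![![1, 1], ![ω, 1], ![ω ^ 2, 1], ![c, 1], ![ω * c, 1], ![ω ^ 2 * c, 1]]

lemma prod_lin_hexad {ω : ℂ} (hω : ω ^ 2 + ω + 1 = 0) (c : ℂ) :
    ∏ i, lin (hexad ω c i) = (X 0 ^ 3 - X 1 ^ 3) * (X 0 ^ 3 - C (c ^ 3) * X 1 ^ 3) := by
  have hω' := C_cube_root hω
  have key (x y : Poly2) : (x - y) * (x - C ω * y) * (x - C ω ^ 2 * y) = x ^ 3 - y ^ 3 := by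
    linear_combination (-(x ^ 2 * y) + C ω * x * y ^ 2 - (C ω - 1) * y ^ 3) * hω'
  rw [C_pow, ← mul_pow, ← key, ← key, Fin.prod_univ_six]
  simp only [hexad, lin, Matrix.cons_val, C_1, C_mul, C_pow]
  ring

lemma wedge_hexad {ω c : ℂ} (hω : ω ^ 2 + ω + 1 = 0) (hc : c ≠ 0) (hc3 : c ^ 3 ≠ 1) :
    ∀ i j, i ≠ j → wedge (hexad ω c i) (hexad ω c j) ≠ 0 := by
  have h3 : ω ^ 3 = 1 := by linear_combination (ω - 1) * hω
  have h0 : ω ≠ 0 := by rintro rfl; norm_num at hω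
  have h1 : ω ≠ 1 := by rintro rfl; norm_num at hω
  have h21 : ω ^ 2 ≠ 1 := fun h => h1 (by linear_combination h3 - ω * h)
  have h2 : ω ^ 2 ≠ ω := fun h => sub_ne_zero_of_cube_root hω (sub_eq_zero.2 h)
  have e0 : c ≠ 1 := by rintro rfl; exact hc3 (by norm_num)
  have e1 : c ≠ ω := by rintro rfl; exact hc3 h3
  have e2 : c ≠ ω ^ 2 := by rintro rfl; exact hc3 (by linear_combination (ω ^ 3 + 1) * h3)
  have key : ∀ i j, i < j → wedge (hexad ω c i) (hexad ω c j) ≠ 0 := by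
    intro i j hij h
    fin_cases i <;> fin_cases j <;> first | exact absurd hij (by decide) | skip
    all_goals simp [wedge, hexad] at h
    all_goals grind
  intro i j hij
  rcases lt_or_gt_of_ne hij with h | h
  · exact key i j h
  · rw [wedge_swap]; exact neg_ne_zero.2 (key j i h)

lemma comp_lin (a b : Fin 2 → ℂ) (x y : ℂ) :
    comp (lin (x • a + y • b)) !![a 0, b 0; a 1, b 1] = C (wedge a b) * lin ![x, y] := by
  simp only [lin, comp_sub, comp_mul, comp_C, comp_X]
  simp only [wedge, Pi.add_apply, Pi.smul_apply, smul_eq_mul, Matrix.of_apply, Matrix.cons_val,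
    C_add, C_sub, C_mul]
  ring

lemma exists_coordinates {a b : Fin 2 → ℂ} (hab : wedge a b ≠ 0) (v : Fin 2 → ℂ) :
    ∃ x y : ℂ, v = x • a + y • b := by
  refine ⟨wedge v b / wedge a b, wedge a v / wedge a b,
    funext (Fin.forall_fin_two.2 ⟨?_, ?_⟩)⟩ <;>
  · simp only [Pi.add_apply, Pi.smul_apply, smul_eq_mul]
    field_simp
    simp only [wedge]
    ring

/-- Any three points of the projective line are `1, ω, ω²` in suitable coordinates. -/
lemma exists_frame {ω : ℂ} (hω : ω ^ 2 + ω + 1 = 0) {v₀ v₁ v₂ : Fin 2 → ℂ}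
    (h01 : wedge v₀ v₁ ≠ 0) (h02 : wedge v₀ v₂ ≠ 0) (h12 : wedge v₁ v₂ ≠ 0) :
    ∃ a b : Fin 2 → ℂ, wedge a b ≠ 0 ∧ ∃ r₀ r₁ r₂ : ℂ,
      v₀ = r₀ • (a + b) ∧ v₁ = r₁ • (ω • a + b) ∧ v₂ = r₂ • (ω ^ 2 • a + b) := by
  have hω0 : ω ≠ 0 := by rintro rfl; norm_num at hω
  obtain ⟨s, t, hst⟩ := exists_coordinates h01 v₂
  have hs : s ≠ 0 := by
    rintro rfl
    exact h12 (by rw [hst]; simp only [wedge, Pi.add_apply, Pi.smul_apply, smul_eq_mul]; ring)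
  have ht : t ≠ 0 := by
    rintro rfl
    exact h02 (by rw [hst]; simp only [wedge, Pi.add_apply, Pi.smul_apply, smul_eq_mul]; ring)
  -- the solution of `a + b = 3 s v₀`, `ω a + b = 3 ω² t v₁`, `ω² a + b = -3 ω v₂`
  refine ⟨((1 - ω ^ 2) * s) • v₀ + ((ω - ω ^ 2) * t) • v₁,
    ((1 - ω) * s) • v₀ + ((ω ^ 2 - ω) * t) • v₁, ?_, (3 * s)⁻¹, (3 * ω ^ 2 * t)⁻¹, (-3 * ω)⁻¹,
    ?_, ?_, ?_⟩
  · have : s * t * (ω ^ 2 - ω) * 3 * wedge v₀ v₁ ≠ 0 :=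
      mul_ne_zero (mul_ne_zero (mul_ne_zero (mul_ne_zero hs ht) (sub_ne_zero_of_cube_root hω))
        (by norm_num)) h01
    convert this using 1
    simp only [wedge, Pi.add_apply, Pi.smul_apply, smul_eq_mul]
    linear_combination (-(s * t * (ω ^ 2 - ω) * (v₀ 0 * v₁ 1 - v₀ 1 * v₁ 0))) * hω
  · rw [eq_inv_smul_iff₀ (by simp [hs])]
    funext i
    simp only [Pi.add_apply, Pi.smul_apply, smul_eq_mul]
    linear_combination (s * v₀ i) * hω
  · rw [eq_inv_smul_iff₀ (by simp [hω0, ht])]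
    funext i
    simp only [Pi.add_apply, Pi.smul_apply, smul_eq_mul]
    linear_combination (s * v₀ i * (ω - 1) + ω * t * v₁ i) * hω
  · rw [eq_inv_smul_iff₀ (mul_ne_zero (by norm_num) hω0), hst]
    funext i
    simp only [Pi.add_apply, Pi.smul_apply, smul_eq_mul]
    linear_combination (s * v₀ i * (ω ^ 2 - ω - 1) + t * v₁ i * (ω ^ 2 - 2 * ω)) * hω

/-- A polynomial `a z² + b z + c` vanishing at the three cube roots of unity is zero. -/
lemma eq_zero_of_cube_roots {ω a b c : ℂ} (hω : ω ^ 2 + ω + 1 = 0) (h₀ : a + b + c = 0)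
    (h₁ : a * ω ^ 2 + b * ω + c = 0) (h₂ : a * ω ^ 4 + b * ω ^ 2 + c = 0) :
    a = 0 ∧ b = 0 ∧ c = 0 := by
  refine ⟨?_, ?_, ?_⟩
  · linear_combination (h₀ + ω * h₁ + ω ^ 2 * h₂ - (a * ((ω - 1) * (ω ^ 3 + 2)) +
      b * (ω ^ 2 - ω + 1) + c) * hω) / 3
  · linear_combination (h₀ + ω ^ 2 * h₁ + ω * h₂ - (a * (ω ^ 3 - ω + 1) +
      b * (2 * (ω - 1)) + c) * hω) / 3
  · linear_combination (h₀ + h₁ + h₂ - (a * (ω ^ 2 - ω + 1) + b) * hω) / 3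

/-- An involutive pairing of distinct points is induced by a nondegenerate bilinear form. -/
lemma polar_nondegenerate {β : Fin 3 → ℂ} (hβ : β ≠ 0) {v₀ v₁ v₂ v₃ : Fin 2 → ℂ}
    (h02 : wedge v₀ v₂ ≠ 0) (h03 : wedge v₀ v₃ ≠ 0) (h12 : wedge v₁ v₂ ≠ 0)
    (h13 : wedge v₁ v₃ ≠ 0) (h01 : polar β v₀ v₁ = 0) (h23 : polar β v₂ v₃ = 0) :
    β 0 * β 2 - β 1 ^ 2 ≠ 0 := by
  intro h
  -- a degenerate form is a product of two equal linear forms, vanishing at one point `e`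
  obtain ⟨α, hα⟩ := IsAlgClosed.exists_pow_nat_eq (β 0) (n := 2) (by norm_num)
  obtain ⟨δ, hδ, hαδ⟩ : ∃ δ, δ ^ 2 = β 2 ∧ α * δ = β 1 := by
    obtain ⟨δ, hδ⟩ := IsAlgClosed.exists_pow_nat_eq (β 2) (n := 2) (by norm_num)
    have : (α * δ - β 1) * (α * δ + β 1) = 0 := by
      linear_combination h + δ ^ 2 * hα + β 0 * hδ
    rcases mul_eq_zero.1 this with h | h
    · exact ⟨δ, hδ, by linear_combination h⟩
    · exact ⟨-δ, by rw [neg_sq, hδ], by linear_combination -h⟩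
  set e : Fin 2 → ℂ := ![α, δ] with he
  have he0 : e ≠ 0 := by
    intro h0
    have h1 : δ = 0 := congrFun h0 1
    have h2 : α = 0 := congrFun h0 0
    refine hβ (funext fun i => ?_)
    fin_cases i
    · simp [← hα, h2]
    · simp [← hαδ, h1]
    · simp [← hδ, h1]
  have hp (v w) : polar β v w = wedge e v * wedge e w := by
    simp only [polar, wedge, he, ← hα, ← hδ, ← hαδ, Matrix.cons_val_zero, Matrix.cons_val_one]
    ring
  have key {v w} (hv : wedge e v = 0) (hw : wedge e w = 0) : wedge v w = 0 := by
    obtain ⟨r, rfl⟩ := exists_smul_of_wedge_eq_zero he0 hv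
    obtain ⟨r', rfl⟩ := exists_smul_of_wedge_eq_zero he0 hw
    simp only [wedge, Pi.smul_apply, smul_eq_mul]; ring
  rw [hp, mul_eq_zero] at h01 h23
  rcases h01 with h | h <;> rcases h23 with h' | h'
  exacts [h02 (key h h'), h03 (key h h'), h12 (key h h'), h13 (key h h')]

/-- If the sides of a hexagon in the projective line alternate between pairs orthogonal for `β`
and pairs orthogonal for `γ`, then its vertices are `1, c, ω, ω² c, ω², ω c` in suitable
coordinates: the product of the two involutions has order three. -/
lemma exists_hexad_coordinates {ω : ℂ} (hω : ω ^ 2 + ω + 1 = 0) {v : Fin 6 → Fin 2 → ℂ}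
    (hv : ∀ i j, i ≠ j → wedge (v i) (v j) ≠ 0) {β γ : Fin 3 → ℂ} (hβ : β ≠ 0) (hγ : γ ≠ 0)
    (h01 : polar β (v 0) (v 1) = 0) (h23 : polar β (v 2) (v 3) = 0)
    (h45 : polar β (v 4) (v 5) = 0) (h12 : polar γ (v 1) (v 2) = 0)
    (h34 : polar γ (v 3) (v 4) = 0) (h50 : polar γ (v 5) (v 0) = 0) :
    ∃ a b : Fin 2 → ℂ, wedge a b ≠ 0 ∧ ∃ (c : ℂ) (r : Fin 6 → ℂ), c ≠ 0 ∧ c ^ 3 ≠ 1 ∧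
      v 0 = r 0 • (a + b) ∧ v 2 = r 1 • (ω • a + b) ∧ v 4 = r 2 • (ω ^ 2 • a + b) ∧
      v 1 = r 3 • (c • a + b) ∧ v 5 = r 4 • ((ω * c) • a + b) ∧
      v 3 = r 5 • ((ω ^ 2 * c) • a + b) := by
  have hω3 : ω ^ 3 = 1 := by linear_combination (ω - 1) * hω
  have hω0 : ω ≠ 0 := by rintro rfl; norm_num at hω
  have hω1 : 1 - ω ≠ 0 := fun h => by
    have : ω = 1 := by linear_combination -h
    rw [this] at hω; norm_num at hω
  have hd {i j : Fin 6} (h : i ≠ j) := hv i j h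
  have hv0 (i) : v i ≠ 0 := ne_zero_of_wedge (hv i (i + 1) (by simp))
  obtain ⟨a, b, hab, r₀, r₁, r₂, e0, e2, e4⟩ :=
    exists_frame hω (hd (i := 0) (j := 2) (by decide)) (hd (i := 0) (j := 4) (by decide))
      (hd (i := 2) (j := 4) (by decide))
  obtain ⟨x₁, y₁, e1⟩ := exists_coordinates hab (v 1)
  obtain ⟨x₃, y₃, e3⟩ := exists_coordinates hab (v 3)
  obtain ⟨x₅, y₅, e5⟩ := exists_coordinates hab (v 5)
  have hr {i : Fin 6} {r : ℂ} {u : Fin 2 → ℂ} (h : v i = r • u) : r ≠ 0 := by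
    rintro rfl; exact hv0 i (by rw [h, zero_smul])
  have hr₀ := hr e0
  have hr₁ := hr e2
  have hr₂ := hr e4
  have nd (δ : Fin 3 → ℂ) (h : δ 0 * δ 2 - δ 1 ^ 2 ≠ 0) :
      polar δ a a * polar δ b b - polar δ a b ^ 2 ≠ 0 := by
    have := mul_ne_zero h (pow_ne_zero 2 hab)
    intro h0
    refine this ?_
    rw [← h0]
    simp only [polar, wedge]; ring
  have ndβ := nd β (polar_nondegenerate hβ (hd (by decide)) (hd (by decide)) (hd (by decide))
    (hd (by decide)) h01 h23)
  have ndγ := nd γ (polar_nondegenerate hγ (hd (by decide)) (hd (by decide)) (hd (by decide))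
    (hd (by decide)) h12 h34)
  have coord (δ : Fin 3 → ℂ) {r x x' y' : ℂ} (hr : r ≠ 0) {u u' : Fin 2 → ℂ}
      (hu : u = r • (x • a + b)) (hu' : u' = x' • a + y' • b) (h : polar δ u u' = 0) :
      (polar δ a a * x + polar δ a b) * x' + (polar δ a b * x + polar δ b b) * y' = 0 := by
    refine (mul_eq_zero.1 (?_ : r * _ = 0)).resolve_left hr
    rw [← h, hu, hu']
    simp only [polar, Pi.add_apply, Pi.smul_apply, smul_eq_mul]
    ring
  have e0' : v 0 = r₀ • ((1 : ℂ) • a + b) := by rw [one_smul]; exact e0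
  have f01 := coord β hr₀ e0' e1 h01
  have f23 := coord β hr₁ e2 e3 h23
  have f45 := coord β hr₂ e4 e5 h45
  have f12 := coord γ hr₁ e2 e1 (by rw [polar_comm]; exact h12)
  have f34 := coord γ hr₂ e4 e3 (by rw [polar_comm]; exact h34)
  have f50 := coord γ hr₀ e0' e5 (by rw [polar_comm]; exact h50)
  set A := polar β a a
  set B := polar β a b
  set D := polar β b b
  set A' := polar γ a a
  set B' := polar γ a b
  set D' := polar γ b b
  -- a nonzero point `(x, y)` satisfies both linear conditions, so their determinant vanishes
  have elim {i : Fin 6} {x y p q p' q' : ℂ} (hx : v i = x • a + y • b)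
      (h : p * x + q * y = 0) (h' : p' * x + q' * y = 0) : p * q' - q * p' = 0 := by
    by_contra h0
    have hx0 : x = 0 := by
      refine (mul_eq_zero.1 (?_ : (p * q' - q * p') * x = 0)).resolve_left h0
      linear_combination q' * h - q * h'
    have hy0 : y = 0 := by
      refine (mul_eq_zero.1 (?_ : (p * q' - q * p') * y = 0)).resolve_left h0
      linear_combination p * h' - p' * h
    exact hv0 i (by rw [hx, hx0, hy0, zero_smul, zero_smul, add_zero])
  have g1 := elim e1 f01 f12
  have g3 := elim e3 f23 f34
  have g5 := elim e5 f45 f50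
  -- `(A z + B) (B' ω z + D') - (B z + D) (A' ω z + B')` vanishes at `z = 1, ω, ω²`
  obtain ⟨c2', c1, c0⟩ := eq_zero_of_cube_roots hω
    (a := ω * (A * B' - B * A')) (b := A * D' - ω * (D * A') - (1 - ω) * (B * B'))
    (c := B * D' - D * B') (by linear_combination g1) (by linear_combination g3)
    (by linear_combination g5 + ((A * ω ^ 2 + B) * B' - (B * ω ^ 2 + D) * A') * hω3)
  have c2 : A * B' - B * A' = 0 := (mul_eq_zero.1 c2').resolve_left hω0
  have hB : B = 0 := by
    refine (mul_eq_zero.1 (?_ : B * ((1 - ω) * (A' * D' - B' ^ 2)) = 0)).resolve_right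
      (mul_ne_zero hω1 ndγ)
    linear_combination B' * c1 - D' * c2 - (ω * A') * c0
  have hB' : B' = 0 := by
    refine (mul_eq_zero.1 (?_ : B' * ((1 - ω) * (A * D - B ^ 2)) = 0)).resolve_right
      (mul_ne_zero hω1 ndβ)
    linear_combination B * c1 - A * c0 - (ω * D) * c2
  have hA : A ≠ 0 := fun h => ndβ (by rw [h, hB]; ring)
  have hD : D ≠ 0 := fun h => ndβ (by rw [h, hB]; ring)
  rw [hB] at f01 f23 f45
  obtain ⟨c, hc⟩ : ∃ c, c = -(D / A) := ⟨_, rfl⟩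
  have hAc : A * c = -D := by rw [hc]; field_simp
  have hc0 : c ≠ 0 := by
    rintro rfl; exact hD (by linear_combination hAc)
  have k1 : x₁ = y₁ * c := by
    refine mul_left_cancel₀ hA ?_
    linear_combination f01 - y₁ * hAc
  have k3 : x₃ = y₃ * (ω ^ 2 * c) := by
    refine mul_left_cancel₀ (mul_ne_zero hA hω0) ?_
    linear_combination f23 - y₃ * hAc - (A * c * y₃) * hω3
  have k5 : x₅ = y₅ * (ω * c) := by
    refine mul_left_cancel₀ (mul_ne_zero hA (pow_ne_zero 2 hω0)) ?_
    linear_combination f45 - y₅ * hAc - (A * c * y₅) * hω3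
  have m1 : v 1 = y₁ • (c • a + b) := by rw [e1, k1, smul_add, smul_smul]
  have m3 : v 3 = y₃ • ((ω ^ 2 * c) • a + b) := by rw [e3, k3, smul_add, smul_smul]
  have m5 : v 5 = y₅ • ((ω * c) • a + b) := by rw [e5, k5, smul_add, smul_smul]
  have par {r s z : ℂ} {i j : Fin 6} (hij : i ≠ j) (hi : v i = r • (z • a + b))
      (hj : v j = s • (c • a + b)) : c ≠ z := by
    rintro rfl
    refine hv i j hij ?_
    rw [hi, hj]
    simp only [wedge, Pi.smul_apply, smul_eq_mul]; ring
  have n0 := par (by decide) e0' m1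
  have n1 := par (by decide) e2 m1
  have n2 := par (by decide) e4 m1
  refine ⟨a, b, hab, c, ![r₀, r₁, r₂, y₁, y₅, y₃], hc0, ?_, e0, e2, e4, m1, m5, m3⟩
  intro hc3
  have : (c - 1) * ((c - ω) * (c - ω ^ 2)) = 0 := by
    linear_combination hc3 + (-c ^ 2 + ω * c - (ω - 1)) * hω
  rcases mul_eq_zero.1 this with h | h
  · exact n0 (sub_eq_zero.1 h)
  rcases mul_eq_zero.1 h with h | h
  · exact n1 (sub_eq_zero.1 h)
  · exact n2 (sub_eq_zero.1 h)

/-- A sextic whose distinct zeros have two disjoint involutive pairings is similar to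
`(x³ - y³) (x³ - c³ y³)` for some `c`. -/
lemma exists_similar_hexad {ω : ℂ} (hω : ω ^ 2 + ω + 1 = 0) {w : Fin 6 → Fin 2 → ℂ}
    (hw : ∀ i j, i ≠ j → wedge (w i) (w j) ≠ 0) {k k' : Fin 15} (hk : Involutive w k)
    (hk' : Involutive w k') (hkk' : ∀ i, pairing k i ≠ pairing k' i) :
    ∃ c, c ≠ 0 ∧ c ^ 3 ≠ 1 ∧ Similar (∏ i, lin (w i)) (∏ i, lin (hexad ω c i)) := by
  obtain ⟨β, hβ, hb⟩ := hk
  obtain ⟨γ, hγ, hg⟩ := hk'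
  obtain ⟨n, hn, h01, h23, h45, h12, h34, h50⟩ := exists_hexagon k k' hkk'
  have hb' {i j : Fin 6} (h : pairing k (n i) = n j) : polar β (w (n i)) (w (n j)) = 0 := by
    rw [← h]; exact hb _
  have hg' {i j : Fin 6} (h : pairing k' (n i) = n j) : polar γ (w (n i)) (w (n j)) = 0 := by
    rw [← h]; exact hg _
  obtain ⟨a, b, hab, c, r, hc, hc3, e0, e2, e4, e1, e5, e3⟩ :=
    exists_hexad_coordinates hω (v := fun i => w (n i))
    (fun i j hij => hw _ _ fun h => hij (hn h)) hβ hγ (hb' h01) (hb' h23) (hb' h45) (hg' h12)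
    (hg' h34) (hg' h50)
  have hw0 (i) : w i ≠ 0 := ne_zero_of_wedge (hw i (i + 1) (by simp))
  have hprod : ∏ i, lin (w i) = ∏ i, lin (w (n i)) :=
    ((Equiv.ofBijective n (Finite.injective_iff_bijective.1 hn)).prod_comp
      (fun i => lin (w i))).symm
  have hcomp {v : Fin 2 → ℂ} {r x : ℂ} (hv : v = r • (x • a + b)) :
      comp (lin v) !![a 0, b 0; a 1, b 1] = C (r * wedge a b) * lin ![x, 1] := by
    have := comp_lin a b x 1
    rw [one_smul] at this
    rw [hv, lin_smul, comp_mul, comp_C, this, C_mul]; ring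
  have hr {i : Fin 6} {r : ℂ} {u : Fin 2 → ℂ} (h : w i = r • u) : r ≠ 0 := by
    rintro rfl; exact hw0 i (by rw [h, zero_smul])
  refine ⟨c, hc, hc3, Similar.of_comp_eq (c := r 0 * r 1 * r 2 * r 3 * r 4 * r 5 * wedge a b ^ 6)
    ?_ !![a 0, b 0; a 1, b 1] ?_ ?_ ?_⟩
  · exact isHomogeneous_prod_lin w
  · rw [Matrix.det_fin_two_of]
    intro h; exact hab (by rw [wedge]; linear_combination h)
  · exact mul_ne_zero (mul_ne_zero (mul_ne_zero (mul_ne_zero (mul_ne_zero (mul_ne_zero (hr e0)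
      (hr e2)) (hr e4)) (hr e1)) (hr e5)) (hr e3)) (pow_ne_zero 6 hab)
  · have e0' : w (n 0) = r 0 • ((1 : ℂ) • a + b) := by rw [one_smul]; exact e0
    rw [hprod, Fin.prod_univ_six, Fin.prod_univ_six]
    simp only [comp_mul, hcomp e0', hcomp e1, hcomp e2, hcomp e3, hcomp e4, hcomp e5, hexad,
      Matrix.cons_val, C_mul, C_pow]
    ring

/-! ### The involutive pairings of the hexagon and of the octahedron -/

/-- The determinant of the coefficient matrix of the three quadratic forms whose zeros are the
pairs of the pairing `k` of the points `w i`. -/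
noncomputable def pairingDet (w : Fin 6 → Fin 2 → ℂ) (k : Fin 15) : ℂ :=
  (Matrix.of fun j : Fin 3 =>
    ![w (pairingRep k j) 1 * w (pairing k (pairingRep k j)) 1,
      -(w (pairingRep k j) 1 * w (pairing k (pairingRep k j)) 0 +
        w (pairingRep k j) 0 * w (pairing k (pairingRep k j)) 1),
      w (pairingRep k j) 0 * w (pairing k (pairingRep k j)) 0]).det

/-- A pairing is involutive iff its three quadratic forms are linearly dependent. -/
lemma involutive_iff {w : Fin 6 → Fin 2 → ℂ} {k : Fin 15} :
    Involutive w k ↔ pairingDet w k = 0 := by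
  rw [pairingDet, ← Matrix.exists_mulVec_eq_zero_iff]
  have hrow (β : Fin 3 → ℂ) (v v' : Fin 2 → ℂ) :
      dotProduct ![v 1 * v' 1, -(v 1 * v' 0 + v 0 * v' 1), v 0 * v' 0] β = polar β v v' := by
    simp only [dotProduct, Fin.sum_univ_three, polar, Matrix.cons_val]; ring
  refine exists_congr fun β => and_congr_right fun _ => ⟨fun h => funext fun j => ?_, fun h i => ?_⟩
  · exact (hrow β _ _).trans (h _)
  · obtain ⟨j, rfl | rfl⟩ := forall_of_pairingRep k i
    · exact (hrow β _ _).symm.trans (congrFun h j)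
    · rw [pairing_pairing, polar_comm]
      exact (hrow β _ _).symm.trans (congrFun h j)

/-- Three pairings of the hexad, induced by the involutions `z ↦ c ωⁱ / z`, are involutive for all
`c`. A further one joins either all of `1, ω, ω²` to `c, ω c, ω² c`, with linearly dependent forms
only if `c³ = -1`, or exactly one of them. In the latter case, after replacing `c` by some `ωⁱ c`,
the forms are `(x - y)(x - c y)`, `x² + x y + y²` and `x² + c x y + c² y²`, which are dependent iff
`c² + 4 c + 1 = 0`; this gives `c³ + c⁻³ = -52`. -/
lemma involutive_hexad {ω c : ℂ} (hω : ω ^ 2 + ω + 1 = 0) (hc : c ≠ 0) (hc3 : c ^ 3 ≠ 1)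
    {k : Fin 15} (hk : Involutive (hexad ω c) k) :
    k ∈ ({8, 10, 14} : Finset (Fin 15)) ∨ c ^ 3 = -1 ∨ c ^ 6 + 52 * c ^ 3 + 1 = 0 := by
  rw [involutive_iff] at hk
  fin_cases k
  all_goals first | exact Or.inl (by decide) | right
  all_goals
    simp [pairingDet, Matrix.det_fin_three, hexad, pairing, pairingRep] at hk
  all_goals first
    -- the pairings that join `1, ω, ω²` to `c, ω c, ω² c`
    | refine Or.inl ?_
      have : (c ^ 3 + 1) * c = 0 := by
        clear hc hc3
        grind
      exact eq_neg_of_add_eq_zero_left ((mul_eq_zero.1 this).resolve_right hc)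
    | refine Or.inr ?_
      have : (c ^ 6 + 52 * c ^ 3 + 1) * (c ^ 3 - 1) = 0 := by
        clear hc hc3
        grind
      exact (mul_eq_zero.1 this).resolve_right (sub_ne_zero.2 hc3)

lemma involutive_hexad_neg_one {ω : ℂ} (hω : ω ^ 2 + ω + 1 = 0) (k : Fin 15) :
    Involutive (hexad ω (-1)) k ↔ k ∈ ({7, 8, 10, 14} : Finset (Fin 15)) := by
  rw [involutive_iff]
  fin_cases k
  all_goals first
    | refine iff_of_true ?_ (by decide)
      simp [pairingDet, Matrix.det_fin_three, hexad, pairing, pairingRep]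
      done
    | refine iff_of_true ?_ (by decide)
      simp [pairingDet, Matrix.det_fin_three, hexad, pairing, pairingRep]
      grind
    | refine iff_of_false (fun hk => ?_) (by decide)
      simp [pairingDet, Matrix.det_fin_three, hexad, pairing, pairingRep] at hk
      grind

/-- The vertices `0, ∞, 1, -1, i, -i` of the octahedron. -/
noncomputable def octahedron : Fin 6 → Fin 2 → ℂ :=
  ![![0, 1], ![-1, 0], ![1, 1], ![-1, 1], ![Complex.I, 1], ![-Complex.I, 1]]

lemma involutive_octahedron (k : Fin 15) :
    Involutive octahedron k ↔ k ∈ ({1, 2, 3, 6, 11, 14} : Finset (Fin 15)) := by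
  rw [involutive_iff]
  have hI := Complex.I_sq
  generalize hJ : Complex.I = J at hI
  fin_cases k
  all_goals first
    | refine iff_of_true ?_ (by decide)
      simp [pairingDet, Matrix.det_fin_three, octahedron, pairing, pairingRep, hJ]
      done
    | refine iff_of_true ?_ (by decide)
      simp [pairingDet, Matrix.det_fin_three, octahedron, pairing, pairingRep, hJ]
      grind
    | refine iff_of_false (fun hk => ?_) (by decide)
      simp [pairingDet, Matrix.det_fin_three, octahedron, pairing, pairingRep, hJ] at hk
      done
    | refine iff_of_false (fun hk => ?_) (by decide)
      simp [pairingDet, Matrix.det_fin_three, octahedron, pairing, pairingRep, hJ] at hk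
      grind

/-! ### Similarities between the special sextics -/

lemma isHomogeneous_Q₁ : Q₁.IsHomogeneous 6 :=
  (isHomogeneous_X_pow 0 6).add (isHomogeneous_X_pow 1 6)

lemma isHomogeneous_Q₂ : Q₂.IsHomogeneous 6 :=
  ((isHomogeneous_X ℂ 0).mul (isHomogeneous_X ℂ 1)).mul
    ((isHomogeneous_X_pow 0 4).sub (isHomogeneous_X_pow 1 4))

/-- A form that becomes `a x⁶ + b x³ y³ + d y⁶` after a change of variables is similar to `B t`
for both square roots `t` of `b² / (a d)`. -/
lemma similar_B_of_comp_eq {f : Poly2} (hf : f.IsHomogeneous 6) (M : Matrix (Fin 2) (Fin 2) ℂ)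
    (hM : M.det ≠ 0) {a b d t : ℂ} (ha : a ≠ 0) (hd : d ≠ 0) (ht : b ^ 2 = t ^ 2 * (a * d))
    (h : comp f M = C a * X 0 ^ 6 + C b * (X 0 ^ 3 * X 1 ^ 3) + C d * X 1 ^ 6) :
    Similar f (B t) := by
  obtain ⟨s, hs⟩ := IsAlgClosed.exists_pow_nat_eq a⁻¹ (n := 6) (by norm_num)
  have hs0 : s ≠ 0 := by
    rintro rfl
    exact inv_ne_zero ha (by rw [← hs]; norm_num)
  obtain ⟨u, hu, hsu⟩ : ∃ u, u ^ 6 = d⁻¹ ∧ b * (s ^ 3 * u ^ 3) = t := by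
    obtain ⟨u, hu⟩ := IsAlgClosed.exists_pow_nat_eq d⁻¹ (n := 6) (by norm_num)
    have : (b * (s ^ 3 * u ^ 3)) ^ 2 = t ^ 2 := by
      rw [show (b * (s ^ 3 * u ^ 3)) ^ 2 = b ^ 2 * (s ^ 6 * u ^ 6) by ring, hs, hu, ht]
      field_simp
    rcases sq_eq_sq_iff_eq_or_eq_neg.1 this with h | h
    · exact ⟨u, hu, h⟩
    · exact ⟨-u, by rw [← hu]; ring, by linear_combination -h⟩
  have hu0 : u ≠ 0 := by
    rintro rfl
    exact inv_ne_zero hd (by rw [← hu]; norm_num)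
  refine Similar.of_comp_eq hf (M * !![s, 0; 0, u]) ?_ one_ne_zero ?_
  · rw [Matrix.det_mul, Matrix.det_fin_two_of]
    simp [hM, hs0, hu0]
  · have e1 : (C a * C s ^ 6 : Poly2) = 1 := by
      rw [← C_pow, ← C_mul, hs, mul_inv_cancel₀ ha, C_1]
    have e2 : (C d * C u ^ 6 : Poly2) = 1 := by
      rw [← C_pow, ← C_mul, hu, mul_inv_cancel₀ hd, C_1]
    have e3 : (C b * (C s ^ 3 * C u ^ 3) : Poly2) = C t := by
      rw [← C_pow, ← C_pow, ← C_mul, ← C_mul, hsu]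
    rw [← comp_comp, h]
    simp only [comp_add, comp_mul, comp_pow, comp_C, comp_X, B, Matrix.of_apply, Matrix.cons_val,
      C_0, C_1]
    linear_combination X 0 ^ 6 * e1 + X 1 ^ 6 * e2 + X 0 ^ 3 * X 1 ^ 3 * e3

/-- The sextic of the hexad is `x⁶ - (1 + c³) x³ y³ + c³ y⁶`, where `(1 + c³)² = -50 c³`. -/
lemma similar_hexad_B {ω : ℂ} (hω : ω ^ 2 + ω + 1 = 0) {c t : ℂ} (hc : c ≠ 0)
    (h : c ^ 6 + 52 * c ^ 3 + 1 = 0) (ht : t ^ 2 = -50) :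
    Similar (∏ i, lin (hexad ω c i)) (B t) := by
  refine similar_B_of_comp_eq (isHomogeneous_prod_lin _) 1 (by simp) (a := 1)
    (b := -(1 + c ^ 3)) (d := c ^ 3) one_ne_zero (pow_ne_zero 3 hc) ?_ ?_
  · rw [ht]; linear_combination h
  · rw [comp_one, prod_lin_hexad hω]
    simp only [C_neg, C_add, C_1]
    ring

/-- In the coordinates given by a pair of opposite face centres of the octahedron, `Q₂` is a
binary quadratic form in the cubes of the variables. -/
lemma similar_Q₂_B {t : ℂ} (ht : t ^ 2 = -50) : Similar Q₂ (B t) := by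
  obtain ⟨r, hr⟩ := IsAlgClosed.exists_pow_nat_eq (3 : ℂ) (n := 2) (by norm_num)
  have hI := Complex.I_sq
  have hI1 : 1 + Complex.I ≠ 0 := fun h => by
    have h1 : Complex.I = -1 := by linear_combination h
    rw [h1] at hI; norm_num at hI
  have hr0 : r ≠ 0 := by rintro rfl; norm_num at hr
  have h1 : r - 1 ≠ 0 := fun h => by
    have h1 : r = 1 := by linear_combination h
    rw [h1] at hr; norm_num at hr
  have h2 : r + 1 ≠ 0 := fun h => by
    have h1 : r = -1 := by linear_combination h
    rw [h1] at hr; norm_num at hr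
  have h3 : 2 - r ≠ 0 := fun h => by
    have h1 : r = 2 := by linear_combination -h
    rw [h1] at hr; norm_num at hr
  have h4 : 2 + r ≠ 0 := fun h => by
    have h1 : r = -2 := by linear_combination h
    rw [h1] at hr; norm_num at hr
  refine similar_B_of_comp_eq isHomogeneous_Q₂
    !![1 + Complex.I, 1 + Complex.I; r - 1, -(r + 1)] ?_
    (a := -16 * ((1 + Complex.I) * (r - 1) * (2 - r)))
    (b := 160 * (1 + Complex.I)) (d := 16 * ((1 + Complex.I) * (r + 1) * (2 + r)))
    (by simp [hI1, h1, h3]) (by simp [hI1, h2, h4]) ?_ ?_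
  · rw [Matrix.det_fin_two_of]
    have := mul_ne_zero (mul_ne_zero (two_ne_zero (α := ℂ)) hI1) hr0
    intro h
    exact this (by linear_combination -h)
  · rw [ht]
    grind
  · have hr' : (C r ^ 2 : Poly2) = 3 := by rw [← C_pow, hr, map_ofNat]
    have hI' : (C Complex.I ^ 2 : Poly2) = -1 := by rw [← C_pow, hI, C_neg, C_1]
    simp only [Q₂, comp_sub, comp_mul, comp_pow, comp_X, Matrix.of_apply, Matrix.cons_val,
      C_neg, C_add, C_sub, C_mul, C_1, map_ofNat]
    grind

lemma similar_Q₂_A : Similar Q₂ (A (-5)) := by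
  obtain ⟨k, hk⟩ := exists_root_quadratic 2 (-1) (one_ne_zero (α := ℂ))
  have hk0 : k ≠ 0 := by rintro rfl; norm_num at hk
  have hk1 : 1 + k ^ 2 ≠ 0 := fun h => by
    have h1 : k = 1 := by linear_combination (hk - h) / 2
    rw [h1] at hk; norm_num at hk
  -- `k = tan (π / 8)`, so this is a rotation by `π / 8`, up to scaling
  refine Similar.of_comp_eq isHomogeneous_Q₂ !![1, -k; k, 1] ?_
    (c := 2 * k ^ 2 * (1 + k ^ 2)) (by simp [hk0, hk1]) ?_
  · rw [Matrix.det_fin_two_of]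
    intro h; exact hk1 (by linear_combination h)
  · have hk' : (C k ^ 2 : Poly2) = 1 - 2 * C k := by
      rw [← C_pow, show k ^ 2 = 1 - 2 * k by linear_combination hk, C_sub, C_mul, C_1, map_ofNat]
    simp only [Q₂, A, comp_sub, comp_mul, comp_pow, comp_X, Matrix.of_apply, Matrix.cons_val,
      C_neg, C_add, C_mul, C_pow, C_1, map_ofNat]
    grind

lemma similar_Q₁_A : Similar Q₁ (A 15) := by
  refine Similar.of_comp_eq isHomogeneous_Q₁ !![1, 1; 1, -1] ?_ (c := 2) two_ne_zero ?_
  · rw [Matrix.det_fin_two_of]; norm_num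
  · simp only [Q₁, A, comp_add, comp_pow, comp_X, Matrix.of_apply, Matrix.cons_val,
      C_neg, C_1, map_ofNat]
    ring

/-- For `c³ = -1` the hexad is the set of sixth roots of unity, the zeros of `x⁶ - y⁶`. -/
lemma similar_Q₁_hexad {ω : ℂ} (hω : ω ^ 2 + ω + 1 = 0) {c : ℂ} (hc : c ^ 3 = -1) :
    Similar Q₁ (∏ i, lin (hexad ω c i)) := by
  refine Similar.of_comp_eq isHomogeneous_Q₁ !![1, 0; 0, Complex.I] ?_ one_ne_zero ?_
  · rw [Matrix.det_fin_two_of]; simp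
  · have hI' : (C Complex.I ^ 2 : Poly2) = -1 := by rw [← C_pow, Complex.I_sq, C_neg, C_1]
    rw [prod_lin_hexad hω, hc]
    simp only [Q₁, comp_add, comp_pow, comp_X, Matrix.of_apply, Matrix.cons_val,
      C_neg, C_1, C_0]
    linear_combination X 1 ^ 6 * (C Complex.I ^ 4 - C Complex.I ^ 2 + 1) * hI'

lemma prod_lin_octahedron : ∏ i, lin (octahedron i) = Q₂ := by
  have hI' : (C Complex.I ^ 2 : Poly2) = -1 := by rw [← C_pow, Complex.I_sq, C_neg, C_1]
  rw [Fin.prod_univ_six]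
  simp only [octahedron, lin, Matrix.cons_val, C_neg, C_1, C_0, Q₂]
  linear_combination (-(X 0 * X 1 * (X 0 ^ 2 - X 1 ^ 2) * X 1 ^ 2)) * hI'

lemma wedge_octahedron : ∀ i j, i ≠ j → wedge (octahedron i) (octahedron j) ≠ 0 := by
  have hI := Complex.I_sq
  generalize hJ : Complex.I = J at hI
  intro i j hij h
  fin_cases i <;> fin_cases j <;> first | exact hij rfl | skip
  all_goals simp [wedge, octahedron, hJ] at h
  all_goals grind

/-! ### The number of representations -/

lemma N_Q₁ : N Q₁ = 4 := by
  obtain ⟨ω, hω⟩ := exists_cube_root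
  rw [(similar_Q₁_hexad hω (c := -1) (by norm_num)).N_eq,
    N_prod_lin (wedge_hexad hω (by norm_num) (by norm_num)),
    show {k | Involutive (hexad ω (-1)) k} = (({7, 8, 10, 14} : Finset (Fin 15)) : Set (Fin 15))
      from Set.ext (involutive_hexad_neg_one hω), Set.encard_coe_eq_coe_finsetCard]
  rfl

lemma N_Q₂ : N Q₂ = 6 := by
  rw [← prod_lin_octahedron, N_prod_lin wedge_octahedron,
    show {k | Involutive octahedron k} =
      (({1, 2, 3, 6, 11, 14} : Finset (Fin 15)) : Set (Fin 15))
      from Set.ext involutive_octahedron, Set.encard_coe_eq_coe_finsetCard]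
  rfl

/-- Among more than three involutive pairings, two are disjoint. -/
lemma exists_disjoint_involutive {w : Fin 6 → Fin 2 → ℂ} (h : 3 < {k | Involutive w k}.encard) :
    ∃ k k', Involutive w k ∧ Involutive w k' ∧ ∀ i, pairing k i ≠ pairing k' i := by
  obtain ⟨S, hS, hcard⟩ := Set.exists_subset_encard_eq
    (show (4 : ℕ∞) ≤ _ from Order.add_one_le_of_lt h)
  obtain ⟨a, b, c, d, hab, hac, had, hbc, hbd, hcd, rfl⟩ := Set.encard_eq_four.1 hcard
  have ha := hS (a := a) (by simp)
  have hb := hS (a := b) (by simp)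
  have hc := hS (a := c) (by simp)
  have hd := hS (a := d) (by simp)
  rcases exists_disjoint_pairings a b c d hab hac had hbc hbd hcd with
    h | h | h | h | h | h
  exacts [⟨a, b, ha, hb, h⟩, ⟨a, c, ha, hc, h⟩, ⟨a, d, ha, hd, h⟩, ⟨b, c, hb, hc, h⟩,
    ⟨b, d, hb, hd, h⟩, ⟨c, d, hc, hd, h⟩]

lemma similar_of_three_lt {p : Poly2} (h : 3 < N p) : Similar p Q₁ ∨ Similar p Q₂ := by
  obtain ⟨ω, hω⟩ := exists_cube_root
  obtain ⟨w, hw, rfl⟩ := exists_prod_lin_of_three_lt h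
  rw [N_prod_lin hw] at h
  obtain ⟨k, k', hk, hk', hkk'⟩ := exists_disjoint_involutive h
  obtain ⟨c, hc, hc3, hs⟩ := exists_similar_hexad hω hw hk hk' hkk'
  -- `8`, `10`, `14` are the pairings of the hexad that are involutive for every `c`
  obtain ⟨l, hl, hl'⟩ : ∃ l, Involutive (hexad ω c) l ∧ l ∉ ({8, 10, 14} : Finset (Fin 15)) := by
    by_contra! hall
    rw [← N_prod_lin hw, hs.N_eq, N_prod_lin (wedge_hexad hω hc hc3)] at h
    refine absurd h (not_lt.2 ((Set.encard_le_encard (t := (({8, 10, 14} : Finset (Fin 15)) :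
      Set (Fin 15))) hall).trans ?_))
    rw [Set.encard_coe_eq_coe_finsetCard]
    rfl
  rcases (involutive_hexad hω hc hc3 hl).resolve_left hl' with h1 | h1
  · exact Or.inl (hs.trans (similar_Q₁_hexad hω h1).symm)
  · obtain ⟨t, ht⟩ := IsAlgClosed.exists_pow_nat_eq (-50 : ℂ) (n := 2) (by norm_num)
    exact Or.inr ((hs.trans (similar_hexad_B hω hc h1 ht)).trans (similar_Q₂_B ht).symm)

end TwoCubes

theorem theorem5p6 :
    (∀ p : TwoCubes.Poly2, p.IsHomogeneous 6 →
      (3 < TwoCubes.N p ↔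
        TwoCubes.Similar p TwoCubes.Q₁ ∨ TwoCubes.Similar p TwoCubes.Q₂)) ∧
    ¬ TwoCubes.Similar TwoCubes.Q₁ TwoCubes.Q₂ ∧
    TwoCubes.N TwoCubes.Q₁ = 4 ∧
    TwoCubes.N TwoCubes.Q₂ = 6 ∧
    TwoCubes.Similar TwoCubes.Q₁ (TwoCubes.A 0) ∧
    TwoCubes.Similar TwoCubes.Q₁ (TwoCubes.A 15) ∧
    TwoCubes.Similar TwoCubes.Q₁ (TwoCubes.B 0) ∧
    TwoCubes.Similar TwoCubes.Q₂ (TwoCubes.A (-5)) ∧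
    TwoCubes.Similar TwoCubes.Q₂ (TwoCubes.B (5 * ((Real.sqrt 2 : ℝ) : ℂ) * Complex.I)) ∧
    TwoCubes.Similar TwoCubes.Q₂ (TwoCubes.B (-(5 * ((Real.sqrt 2 : ℝ) : ℂ) * Complex.I))) := by
  have ht : (5 * ((Real.sqrt 2 : ℝ) : ℂ) * Complex.I) ^ 2 = -50 := by
    have h2 : ((Real.sqrt 2 : ℝ) : ℂ) ^ 2 = 2 := by
      rw [← Complex.ofReal_pow, Real.sq_sqrt (by norm_num)]; norm_num
    rw [mul_pow, mul_pow, h2, Complex.I_sq]; norm_num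
  have hA : TwoCubes.A 0 = TwoCubes.Q₁ := by simp [TwoCubes.A, TwoCubes.Q₁]
  have hB : TwoCubes.B 0 = TwoCubes.Q₁ := by simp [TwoCubes.B, TwoCubes.Q₁]
  refine ⟨fun p _ => ⟨TwoCubes.similar_of_three_lt, ?_⟩, fun h => ?_, TwoCubes.N_Q₁, TwoCubes.N_Q₂,
    ?_, TwoCubes.similar_Q₁_A, ?_, TwoCubes.similar_Q₂_A, TwoCubes.similar_Q₂_B ht,
    TwoCubes.similar_Q₂_B (by rw [neg_sq, ht])⟩
  · rintro (h | h) <;> rw [h.N_eq]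
    · rw [TwoCubes.N_Q₁]; norm_num
    · rw [TwoCubes.N_Q₂]; norm_num
  · have := h.N_eq
    rw [TwoCubes.N_Q₁, TwoCubes.N_Q₂] at this
    norm_num at this
  · rw [hA]; exact TwoCubes.Similar.refl _
  · rw [hB]; exact TwoCubes.Similar.refl _
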